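/- Let $X$ and $U$ be (real or complex) Hilbert spaces, let $-A$, with $A:D(A)\subset X\to X$, be the infinitesimal generator of a $C_0$-semigroup $(S(t))_{t\ge 0}$ on $X$, let $X_{-1}$ denote the dual of $D(A^*)$ (with the graph norm) with respect to the pivot space $X$, and let $B\in L(U,X_{-1})$ be an admissible control operator, i.e. for some $\tau>0$ one has $\int_0^\tau S(\tau-\sigma)Bu(\sigma)\,d\sigma\in X$ for all $u\in L^2(0,\tau;U)$, where $S(t)$ is extended to $X_{-1}$. For $T>0$, $x_0\in X$ and $u\in L^2(0,T;U)$, the state $x\in C([0,T];X)$ is the solution of $$x'+Ax=Bu,\qquad x(0)=x_0, \tag{1}$$ understood in integrated form in $X_{-1}$. Let $0<t_0<T$. Assume that (1) is exactly controllable with $L^2$-controls in time $t_0$ with constant $C_1>0$: for all $x_0,x_1\in X$ there is $u\in L^2(0,t_0;U)$ such that the solution $x$ of (1) on $[0,t_0]$ satisfies $x(t_0)=x_1$ and $\|u\|_{L^2(0,t_0;U)}\le C_1(\|x_0\|_X+\|x_1\|_X)$. Fix $x_0,x_d\in X$, $u_d\in U$ and a control $u_{\rm exact}\in L^2(0,t_0;U)$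 that steers $x_0$ to $x_d$ in time $t_0$, and assume that $x_d$ is holdable: if $u_{\rm exact}$ is extended to $[0,T]$ by the constant control $u_d$ on $(t_0,T)$, the corresponding state equals $x_d$ on $[t_0,T]$. Consider the problem $$\mathbf P(T,\gamma):\quad \min_{u\in L^2(0,T;U)}\ \tfrac12\|u-u_d\|^2_{L^2(0,T;U)}+\gamma\max_{t\in[t_0,T]}\|x(t)-x_d\|_X\quad\text{subject to (1)}.$$ If $\gamma>C_1\,\|u_{\rm exact}-u_d\|_{L^2(0,t_0;U)}$, then $\mathbf P(T,\gamma)$ has a unique solution $(u_T,x_T)$, and $x_T(t)=x_d$ for all $t\in[t_0,T]$. -/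

import Mathlib

open MeasureTheory Filter Set Topology
open scoped NNReal InnerProduct

set_option linter.unusedSectionVars false

namespace ExactControl

/-- A strongly continuous semigroup (`C₀`-semigroup) `(S(t))_{t ≥ 0}` of bounded linear operators
on the Hilbert space `X`. -/
structure C0Semigroup (𝕜 X : Type*) [RCLike 𝕜] [NormedAddCommGroup X]
    [InnerProductSpace 𝕜 X] where
  /-- the operators `S(t)`, `t ≥ 0` -/
  op : ℝ≥0 → X →L[𝕜] X
  op_zero : op 0 = ContinuousLinearMap.id 𝕜 X
  op_add : ∀ s t, op (s + t) = (op s).comp (op t)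
  continuous_op : ∀ x, Continuous fun t => op t x

section

variable {𝕜 X U : Type*} [RCLike 𝕜]
  [NormedAddCommGroup X] [InnerProductSpace 𝕜 X] [CompleteSpace X]
  [NormedAddCommGroup U] [InnerProductSpace 𝕜 U] [CompleteSpace U]

/-- The unbounded operator `G` is the infinitesimal generator of the semigroup `S`: `x ∈ D(G)` and
`G x = y` if and only if `(S(h) x - x) / h → y` as `h → 0+`. -/
def C0Semigroup.IsGenerator (S : C0Semigroup 𝕜 X) (G : X →ₗ.[𝕜] X) : Prop :=
  ∀ x y : X, (x, y) ∈ G.graph ↔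
    Tendsto (fun h : ℝ≥0 => ((h : ℝ) : 𝕜)⁻¹ • (S.op h x - x)) (𝓝[>] 0) (𝓝 y)

/-- The extrapolation space `X₋₁`: the dual of `D(A*)` with respect to the pivot space `X`, that
is, the space of bounded conjugate-linear functionals on `D(A*)` endowed with the graph norm.
The normed space `D(A*)` is realized as the graph `{(ψ, A*ψ)}` in `X × X`. -/
abbrev Extrapolation (A : X →ₗ.[𝕜] X) : Type _ :=
  ↥(A.adjoint.graph) →L⋆[𝕜] 𝕜

/-- The canonical embedding `X → X₋₁`, `x ↦ (ψ ↦ ⟨x, ψ⟩)`; Mathlib's inner product is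
conjugate-linear in its first slot. -/
noncomputable def embed (A : X →ₗ.[𝕜] X) (x : X) : Extrapolation A :=
  ((innerSL 𝕜 : X →L⋆[𝕜] X →L[𝕜] 𝕜).flip x).comp
    ((ContinuousLinearMap.fst 𝕜 X X).comp A.adjoint.graph.subtypeL)

/-- The extension of `A` to a bounded operator `X → X₋₁`, `x ↦ (ψ ↦ ⟨x, A*ψ⟩)`. -/
noncomputable def extendedOp (A : X →ₗ.[𝕜] X) (x : X) : Extrapolation A :=
  ((innerSL 𝕜 : X →L⋆[𝕜] X →L[𝕜] 𝕜).flip x).comp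
    ((ContinuousLinearMap.snd 𝕜 X X).comp A.adjoint.graph.subtypeL)

@[simp] lemma embed_apply (A : X →ₗ.[𝕜] X) (x : X) (p : A.adjoint.graph) :
    embed A x p = inner 𝕜 p.1.1 x := rfl

@[simp] lemma extendedOp_apply (A : X →ₗ.[𝕜] X) (x : X) (p : A.adjoint.graph) :
    extendedOp A x p = inner 𝕜 p.1.2 x := rfl

/-- If `A` is densely defined, `(ψ, A*ψ)` pairs are characterized by `⟨A*ψ, x⟩ = ⟨ψ, A x⟩`. -/
lemma mem_adjoint_graph (A : X →ₗ.[𝕜] X) (hd : Dense (A.domain : Set X)) (p : X × X) :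
    p ∈ A.adjoint.graph ↔ ∀ x y, (x, y) ∈ A.graph → inner 𝕜 p.2 x = inner 𝕜 p.1 y := by
  rw [LinearPMap.adjoint_graph_eq_graph_adjoint hd, Submodule.mem_adjoint_iff]
  refine forall₂_congr fun x y => imp_congr_right fun _ => ?_
  rw [sub_eq_zero, ← inner_conj_symm y, ← inner_conj_symm x]
  exact ⟨fun h => ((starRingEnd 𝕜).injective h).symm, fun h => by rw [h]⟩

lemma neg_mem_graph {A : X →ₗ.[𝕜] X} {x y : X} : (x, y) ∈ A.graph ↔ (x, -y) ∈ (-A).graph := by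
  simp only [LinearPMap.mem_graph_iff, LinearPMap.neg_apply, neg_inj]
  rfl

/-- Generators are densely defined. -/
lemma C0Semigroup.IsGenerator.dense {S : C0Semigroup 𝕜 X} {G : X →ₗ.[𝕜] X}
    (hG : S.IsGenerator G) : Dense (G.domain : Set X) := by
  let _ : NormedSpace ℝ X := NormedSpace.restrictScalars ℝ 𝕜 X
  have : IsScalarTower ℝ 𝕜 X := RestrictScalars.isScalarTower ℝ 𝕜 X
  intro x
  set f : ℝ → X := fun s => S.op s.toNNReal x with hf
  have fc : Continuous f := (S.continuous_op x).comp continuous_real_toNNReal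
  set F : ℝ → X := fun t => ∫ s in (0 : ℝ)..t, f s with hF
  have hder : ∀ t, HasDerivAt F (f t) t := fun t =>
    intervalIntegral.integral_hasDerivAt_right (fc.intervalIntegrable _ _)
      (fc.stronglyMeasurableAtFilter _ _) fc.continuousAt
  have f0 : f 0 = x := by simp [hf, S.op_zero]
  have F0 : F 0 = 0 := by simp [hF]
  have hslope : ∀ t, Tendsto (fun r : ℝ≥0 => ((r : ℝ) : 𝕜)⁻¹ • (F (t + r) - F t)) (𝓝[>] 0)
      (𝓝 (f t)) := by
    intro t
    have h1 := (hasDerivAt_iff_tendsto_slope_zero.1 (hder t))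
    have h2 : Tendsto (fun r : ℝ≥0 => (r : ℝ)) (𝓝[>] 0) (𝓝[≠] 0) := by
      refine tendsto_nhdsWithin_iff.2 ⟨?_, ?_⟩
      · exact (NNReal.continuous_coe.tendsto' 0 0 rfl).mono_left nhdsWithin_le_nhds
      · filter_upwards [self_mem_nhdsWithin] with r hr
        have : 0 < r := hr
        simpa using this.ne'
    refine (h1.comp h2).congr fun r => ?_
    simp only [Function.comp]
    rw [RCLike.real_smul_eq_coe_smul (K := 𝕜), RCLike.ofReal_inv]
  have hmem : ∀ h : ℝ≥0, F h ∈ G.domain := by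
    intro h
    refine LinearPMap.mem_domain_of_mem_graph (y := f h - f 0) ((hG _ _).2 ?_)
    refine ((hslope h).sub (hslope 0)).congr fun r => ?_
    have e1 : S.op r (F h) = F (h + r) - F r := by
      rw [hF]
      simp only
      rw [← ContinuousLinearMap.intervalIntegral_comp_comm (𝕜 := 𝕜) _ (fc.intervalIntegrable _ _),
        intervalIntegral.integral_interval_sub_left (fc.intervalIntegrable _ _)
          (fc.intervalIntegrable _ _)]
      have := intervalIntegral.integral_comp_add_right (a := 0) (b := (h : ℝ)) f (r : ℝ)
      rw [zero_add] at this
      rw [← this]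
      refine intervalIntegral.integral_congr fun s hs => ?_
      rw [uIcc_of_le (NNReal.coe_nonneg h)] at hs
      simp only [hf]
      rw [Real.toNNReal_add hs.1 (NNReal.coe_nonneg r), Real.toNNReal_coe, add_comm s.toNNReal r, S.op_add]
      rfl
    rw [e1, F0, zero_add, ← smul_sub]
    congr 1
    abel
  have hlim := hslope 0
  rw [f0] at hlim
  refine mem_closure_of_tendsto hlim (Eventually.of_forall fun r => ?_)
  rw [F0, zero_add, sub_zero]
  exact G.domain.smul_mem _ (hmem r)

/-- The domain of the generator is invariant under the semigroup, which commutes with it. -/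
lemma C0Semigroup.IsGenerator.op_mem {S : C0Semigroup 𝕜 X} {G : X →ₗ.[𝕜] X}
    (hG : S.IsGenerator G) (t : ℝ≥0) {x y : X} (h : (x, y) ∈ G.graph) :
    (S.op t x, S.op t y) ∈ G.graph := by
  rw [hG] at h ⊢
  have := ((S.op t).continuous.tendsto y).comp h
  refine this.congr fun s => ?_
  have e : S.op t (S.op s x) = S.op s (S.op t x) := by
    rw [← ContinuousLinearMap.comp_apply, ← ContinuousLinearMap.comp_apply, ← S.op_add,
      ← S.op_add, add_comm]
  simp [e]

/-- `D(A*)` is invariant under the adjoint semigroup, which commutes with `A*`. -/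
lemma C0Semigroup.IsGenerator.adjoint_mem {S : C0Semigroup 𝕜 X} {A : X →ₗ.[𝕜] X}
    (hA : S.IsGenerator (-A)) (t : ℝ≥0) {p : X × X} (hp : p ∈ A.adjoint.graph) :
    ((S.op t).adjoint p.1, (S.op t).adjoint p.2) ∈ A.adjoint.graph := by
  have hd : Dense (A.domain : Set X) := hA.dense
  rw [mem_adjoint_graph A hd] at hp ⊢
  intro x y hxy
  have h1 : (S.op t x, S.op t y) ∈ A.graph := by
    have := hA.op_mem t (neg_mem_graph.1 hxy)
    rw [map_neg] at this
    exact neg_mem_graph.2 this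
  rw [ContinuousLinearMap.adjoint_inner_left, ContinuousLinearMap.adjoint_inner_left]
  exact hp _ _ h1

/-- The adjoint semigroup `S(t)*` as a bounded operator on `D(A*)` with the graph norm. -/
noncomputable def adjointRestrict {S : C0Semigroup 𝕜 X} {A : X →ₗ.[𝕜] X}
    (hA : S.IsGenerator (-A)) (t : ℝ≥0) : A.adjoint.graph →L[𝕜] A.adjoint.graph :=
  (((S.op t).adjoint.prodMap (S.op t).adjoint).comp A.adjoint.graph.subtypeL).codRestrict
    A.adjoint.graph fun p => hA.adjoint_mem t p.2

/-- The extension of the semigroup operator `S(t)` to `X₋₁`, `f ↦ f ∘ S(t)*`. -/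
noncomputable def extendedSemigroup {S : C0Semigroup 𝕜 X} {A : X →ₗ.[𝕜] X}
    (hA : S.IsGenerator (-A)) (t : ℝ≥0) (f : Extrapolation A) : Extrapolation A :=
  f.comp (adjointRestrict hA t)

/-- On `X`, the extension agrees with the original semigroup. -/
lemma extendedSemigroup_embed {S : C0Semigroup 𝕜 X} {A : X →ₗ.[𝕜] X}
    (hA : S.IsGenerator (-A)) (t : ℝ≥0) (x : X) :
    extendedSemigroup hA t (embed A x) = embed A (S.op t x) := by
  ext p
  change inner 𝕜 ((S.op t).adjoint p.1.1) x = inner 𝕜 p.1.1 (S.op t x)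
  rw [ContinuousLinearMap.adjoint_inner_left]

/-- The control space `L²(0, T; U)`. -/
abbrev L2 (U : Type*) [NormedAddCommGroup U] (T : ℝ) : Type _ :=
  Lp U 2 (volume.restrict (Ioo (0 : ℝ) T))

/-- The constant control with value `c` in `L²(0, T; U)`. -/
noncomputable abbrev constControl (T : ℝ) (c : U) : L2 U T :=
  Lp.const 2 (volume.restrict (Ioo (0 : ℝ) T)) c

/-- The input map `Φ_τ u = ∫₀^τ S(τ - σ) B u(σ) dσ`, a Bochner integral in `X₋₁`. -/
noncomputable def inputMap {S : C0Semigroup 𝕜 X} {A : X →ₗ.[𝕜] X} (hA : S.IsGenerator (-A))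
    (B : U →L[𝕜] Extrapolation A) (τ : ℝ) (u : L2 U τ) : Extrapolation A :=
  ∫ σ in Ioo (0 : ℝ) τ, extendedSemigroup hA (τ - σ).toNNReal (B (u σ))

/-- `B ∈ L(U, X₋₁)` is an admissible control operator: for some `τ > 0`, the input map `Φ_τ` takes
its values in `X`. -/
def IsAdmissible {S : C0Semigroup 𝕜 X} {A : X →ₗ.[𝕜] X} (hA : S.IsGenerator (-A))
    (B : U →L[𝕜] Extrapolation A) : Prop :=
  ∃ τ : ℝ, 0 < τ ∧ ∀ u : L2 U τ, inputMap hA B τ u ∈ range (embed A)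

/-- `x ∈ C([0, T]; X)` is a solution of `x' + A x = B u`, `x(0) = x₀` on `[0, T]`; the differential
equation holds in `X₋₁` in integrated form. Only the values of `x` on `[0, T]` matter. -/
def IsSolution (A : X →ₗ.[𝕜] X) (B : U →L[𝕜] Extrapolation A) (T : ℝ) (x₀ : X)
    (u : L2 U T) (x : ℝ → X) : Prop :=
  ContinuousOn x (Icc 0 T) ∧ x 0 = x₀ ∧
    ∀ t ∈ Icc (0 : ℝ) T,
      embed A (x t) = embed A x₀ + ∫ s in (0 : ℝ)..t, (B (u s) - extendedOp A (x s))

/-- Exact controllability using `L²`-controls in time `t₀`, with constant `C₁ > 0`. -/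
def IsExactlyControllable (A : X →ₗ.[𝕜] X) (B : U →L[𝕜] Extrapolation A) (t₀ C₁ : ℝ) : Prop :=
  0 < C₁ ∧ ∀ x₀ x₁ : X, ∃ (u : L2 U t₀) (x : ℝ → X),
    IsSolution A B t₀ x₀ u x ∧ x t₀ = x₁ ∧ ‖u‖ ≤ C₁ * (‖x₀‖ + ‖x₁‖)

/-- The control `uExact ∈ L²(0, t₀; U)` steers `x₀` to `xd` in time `t₀`, and `xd` is holdable:
extending `uExact` by the constant control `ud` on `[t₀, T]` keeps the state at `xd`. -/
def IsHoldable (A : X →ₗ.[𝕜] X) (B : U →L[𝕜] Extrapolation A) (t₀ T : ℝ) (x₀ xd : X) (ud : U)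
    (uExact : L2 U t₀) : Prop :=
  ∃ (v : L2 U T) (x : ℝ → X), IsSolution A B T x₀ v x ∧
    (∀ᵐ t ∂volume.restrict (Ioo 0 t₀), v t = uExact t) ∧
    (∀ᵐ t ∂volume.restrict (Ioo t₀ T), v t = ud) ∧
    ∀ t ∈ Icc t₀ T, x t = xd

/-- The objective functional
`½ ‖u - ud‖²_{L²(0,T;U)} + γ max_{t ∈ [t₀, T]} ‖x(t) - xd‖` of problem `P(T, γ)`. -/
noncomputable def cost (t₀ T γ : ℝ) (xd : X) (ud : U) (u : L2 U T) (x : ℝ → X) : ℝ :=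
  1 / 2 * ‖u - constControl T ud‖ ^ 2 + γ * sSup ((fun t => ‖x t - xd‖) '' Icc t₀ T)

/-- `(u, x)` is an optimal control/state pair of problem `P(T, γ)`. -/
def IsOptimal (A : X →ₗ.[𝕜] X) (B : U →L[𝕜] Extrapolation A) (t₀ T γ : ℝ) (x₀ xd : X) (ud : U)
    (u : L2 U T) (x : ℝ → X) : Prop :=
  IsSolution A B T x₀ u x ∧
    ∀ (u' : L2 U T) (x' : ℝ → X), IsSolution A B T x₀ u' x' →
      cost t₀ T γ xd ud u x ≤ cost t₀ T γ xd ud u' x'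

end

end ExactControl

/-! The penalty is exact, and an optimal pair can be written down. Let `e = uExact - ud` on `(0,
t₀)` and let `K` be the subspace of controls steering `0` to `0` in time `t₀`. Subtracting from
`uExact` the orthogonal projection `k` of `e` onto `K` gives the cheapest way to reach `xd`;
afterwards `ud` holds the state there. For a competitor `u + q` whose state misses `xd` by `d` at
time `t₀`, controllability gives `w` steering `0` to `-d` with `‖w‖ ≤ C₁‖d‖`. Then `q + w` lies in
`K` on `(0, t₀)`, and `e - k ⟂ K` gives `Re⟪u - ud, q⟫ = -Re⟪e - k, w⟫ ≥ -C₁‖e‖‖d‖`. The penalty is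
at least `γ‖d‖`, so the cost grows by at least `½‖q‖²`: this is optimality and uniqueness at once.

The analytic work is the closedness of `K` (`isClosed_nullControls`), which rests on the bound
`‖x(t)‖ ≤ C‖u‖` for states starting at `0` (`exists_norm_state_le`). That bound also gives
uniqueness of the state. It follows from admissibility at a single time `τ`: the closed graph
theorem bounds the input map (`exists_norm_le_of_emb_eq_input`), Duhamel's formula transfers this to
continuously differentiable states (`exists_norm_le_of_regular`), and difference quotients of `∫ x`
reach general states (`exists_norm_le_of_integral_eq`). -/

namespace ExactControl

/-! ### The semigroup on `X` and its extension to `X₋₁` -/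

section Semigroup

variable {𝕜 X : Type*} [RCLike 𝕜]
  [NormedAddCommGroup X] [InnerProductSpace 𝕜 X] [CompleteSpace X]

/-- `C₀`-semigroups are locally bounded. -/
lemma C0Semigroup.exists_norm_op_le (S : C0Semigroup 𝕜 X) (R : ℝ≥0) :
    ∃ M : ℝ, 0 ≤ M ∧ ∀ r ≤ R, ‖S.op r‖ ≤ M := by
  obtain ⟨C, hC⟩ := banach_steinhaus (g := fun r : Icc (0 : ℝ≥0) R => S.op r) fun x => by
    obtain ⟨C, hC⟩ := (isCompact_Icc (a := (0 : ℝ≥0)) (b := R)).exists_bound_of_continuousOn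
      (S.continuous_op x).continuousOn
    exact ⟨C, fun i => hC i i.2⟩
  exact ⟨max C 0, le_max_right _ _, fun r hr => (hC ⟨r, bot_le, hr⟩).trans (le_max_left _ _)⟩

/-- A family of uniformly locally bounded operators that is strongly continuous is jointly
continuous. -/
lemma continuous_uncurry_of_strong {E : Type*} [NormedAddCommGroup E] (f : ℝ≥0 → E → E)
    (hsub : ∀ r a b, f r (a - b) = f r a - f r b) (hc : ∀ a, Continuous fun r => f r a)
    (hb : ∀ R, ∃ M : ℝ, ∀ r ≤ R, ∀ a, ‖f r a‖ ≤ M * ‖a‖) :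
    Continuous fun p : ℝ≥0 × E => f p.1 p.2 := by
  rw [continuous_iff_continuousAt]
  rintro ⟨r₀, a₀⟩
  obtain ⟨M, hM⟩ := hb (r₀ + 1)
  have h1 : Tendsto (fun p : ℝ≥0 × E => M * ‖p.2 - a₀‖) (𝓝 (r₀, a₀)) (𝓝 0) := by
    have : Continuous fun p : ℝ≥0 × E => M * ‖p.2 - a₀‖ := by fun_prop
    exact this.tendsto' _ _ (by simp)
  have h2 : Tendsto (fun p : ℝ≥0 × E => f p.1 (p.2 - a₀)) (𝓝 (r₀, a₀)) (𝓝 0) := by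
    refine squeeze_zero_norm' ?_ h1
    have : ∀ᶠ p : ℝ≥0 × E in 𝓝 (r₀, a₀), p.1 < r₀ + 1 :=
      continuous_fst.continuousAt.eventually_lt continuousAt_const (by simp)
    filter_upwards [this] with p hp using hM _ hp.le _
  have h3 : Tendsto (fun p : ℝ≥0 × E => f p.1 a₀) (𝓝 (r₀, a₀)) (𝓝 (f r₀ a₀)) :=
    ((hc a₀).comp continuous_fst).tendsto (r₀, a₀)
  have h4 := h2.add h3
  rw [zero_add] at h4
  refine h4.congr fun p => ?_
  rw [hsub]
  abel

lemma C0Semigroup.continuous_uncurry (S : C0Semigroup 𝕜 X) :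
    Continuous fun p : ℝ≥0 × X => S.op p.1 p.2 := by
  refine continuous_uncurry_of_strong (fun r x => S.op r x) (fun r a b => map_sub _ _ _)
    S.continuous_op fun R => ?_
  obtain ⟨M, -, hM⟩ := S.exists_norm_op_le R
  exact ⟨M, fun r hr a => (S.op r).le_of_opNorm_le (hM r hr) a⟩

lemma C0Semigroup.continuous_op_apply (S : C0Semigroup 𝕜 X) {α : Type*} [TopologicalSpace α]
    {r : α → ℝ} {x : α → X} (hr : Continuous r) (hx : Continuous x) :
    Continuous fun a => S.op (r a).toNNReal (x a) :=
  S.continuous_uncurry.comp ((continuous_real_toNNReal.comp hr).prodMk hx)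

/-- The canonical embedding `X → X₋₁` as a continuous linear map. -/
noncomputable def embedL (A : X →ₗ.[𝕜] X) : X →L[𝕜] Extrapolation A :=
  LinearMap.mkContinuous
    { toFun := embed A
      map_add' := fun x y => by ext p; simp [inner_add_right]
      map_smul' := fun c x => by ext p; simp [inner_smul_right] } 1 fun x => by
    refine ContinuousLinearMap.opNorm_le_bound _ (by positivity) fun p => ?_
    refine (norm_inner_le_norm (𝕜 := 𝕜) p.1.1 x).trans ?_
    rw [mul_comm, one_mul]
    gcongr
    exact norm_fst_le p.1

/-- The extension `X → X₋₁` of `A` as a continuous linear map. -/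
noncomputable def extendedOpL (A : X →ₗ.[𝕜] X) : X →L[𝕜] Extrapolation A :=
  LinearMap.mkContinuous
    { toFun := extendedOp A
      map_add' := fun x y => by ext p; simp [inner_add_right]
      map_smul' := fun c x => by ext p; simp [inner_smul_right] } 1 fun x => by
    refine ContinuousLinearMap.opNorm_le_bound _ (by positivity) fun p => ?_
    refine (norm_inner_le_norm (𝕜 := 𝕜) p.1.2 x).trans ?_
    rw [mul_comm, one_mul]
    gcongr
    exact norm_snd_le p.1

/-- On `D(A*)` the operator `S(t)*` commutes with `A*`, so `S(t)*` only has to be moved across the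
inner product. With `extendedSemigroup_embed` this determines the extended semigroup on every `a + A
b`. -/
lemma extendedSemigroup_extendedOp {S : C0Semigroup 𝕜 X} {A : X →ₗ.[𝕜] X}
    (hA : S.IsGenerator (-A)) (t : ℝ≥0) (x : X) :
    extendedSemigroup hA t (extendedOp A x) = extendedOp A (S.op t x) := by
  ext p
  change inner 𝕜 ((S.op t).adjoint p.1.2) x = inner 𝕜 p.1.2 (S.op t x)
  rw [ContinuousLinearMap.adjoint_inner_left]

lemma extendedSemigroup_add {S : C0Semigroup 𝕜 X} {A : X →ₗ.[𝕜] X}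
    (hA : S.IsGenerator (-A)) (t : ℝ≥0) (f g : Extrapolation A) :
    extendedSemigroup hA t (f + g) = extendedSemigroup hA t f + extendedSemigroup hA t g := rfl

lemma extendedSemigroup_sub {S : C0Semigroup 𝕜 X} {A : X →ₗ.[𝕜] X}
    (hA : S.IsGenerator (-A)) (t : ℝ≥0) (f g : Extrapolation A) :
    extendedSemigroup hA t (f - g) = extendedSemigroup hA t f - extendedSemigroup hA t g := rfl

lemma extendedSemigroup_smul {S : C0Semigroup 𝕜 X} {A : X →ₗ.[𝕜] X}
    (hA : S.IsGenerator (-A)) (t : ℝ≥0) (c : 𝕜) (f : Extrapolation A) :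
    extendedSemigroup hA t (c • f) = c • extendedSemigroup hA t f := rfl

/-- Every element of `X₋₁` is of the form `a + A b` with `a b : X`. -/
lemma exists_eq_embed_add_extendedOp (A : X →ₗ.[𝕜] X) (f : Extrapolation A) :
    ∃ a b : X, f = embed A a + extendedOp A b := by
  -- Elements of `X₋₁` are conjugate-linear, so the conjugate of `f` is extended from the graph to
  -- `X × X` by Hahn–Banach; Riesz represents its two components.
  let g : StrongDual 𝕜 A.adjoint.graph :=
    ((RCLike.conjCLE (K := 𝕜) : 𝕜 ≃L[ℝ] 𝕜).continuous.comp f.continuous |> fun h =>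
    { toFun := fun p => starRingEnd 𝕜 (f p)
      map_add' := fun p q => by simp
      map_smul' := fun c p => by simp
      cont := h })
  obtain ⟨G, hG, -⟩ := exists_extension_norm_eq A.adjoint.graph g
  refine ⟨(InnerProductSpace.toDual 𝕜 X).symm (G.comp (ContinuousLinearMap.inl 𝕜 X X)),
    (InnerProductSpace.toDual 𝕜 X).symm (G.comp (ContinuousLinearMap.inr 𝕜 X X)), ?_⟩
  ext p
  have h : starRingEnd 𝕜 (f p) = G p.1 := (hG p).symm
  rw [_root_.add_apply, embed_apply, extendedOp_apply, ← inner_conj_symm,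
    ← inner_conj_symm (p.1.2), ← map_add, InnerProductSpace.toDual_symm_apply,
    InnerProductSpace.toDual_symm_apply, ContinuousLinearMap.comp_apply,
    ContinuousLinearMap.comp_apply, ← map_add]
  simp [← h]

/-- The adjoint semigroup acts on the graph componentwise, the norm there is the maximum of the two
component norms, and `S(t)*` has the norm of `S(t)`. -/
lemma norm_extendedSemigroup_le {S : C0Semigroup 𝕜 X} {A : X →ₗ.[𝕜] X}
    (hA : S.IsGenerator (-A)) (t : ℝ≥0) (f : Extrapolation A) :
    ‖extendedSemigroup hA t f‖ ≤ ‖S.op t‖ * ‖f‖ := by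
  refine ContinuousLinearMap.opNorm_le_bound _ (by positivity) fun p => ?_
  refine (f.le_opNorm (adjointRestrict hA t p)).trans ?_
  have h : ∀ x, ‖(S.op t).adjoint x‖ ≤ ‖S.op t‖ * ‖x‖ := fun x =>
    (ContinuousLinearMap.le_opNorm _ _).trans_eq (by rw [LinearIsometryEquiv.norm_map])
  have : ‖adjointRestrict hA t p‖ ≤ ‖S.op t‖ * ‖p‖ := by
    refine max_le ((h p.1.1).trans ?_) ((h p.1.2).trans ?_)
    · gcongr; exact norm_fst_le p.1
    · gcongr; exact norm_snd_le p.1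
  calc ‖f‖ * ‖adjointRestrict hA t p‖ ≤ ‖f‖ * (‖S.op t‖ * ‖p‖) := by gcongr
    _ = _ := by ring

lemma continuous_map_add_map {E α : Type*} [NormedAddCommGroup E] [NormedSpace 𝕜 E]
    [TopologicalSpace α] (e a : X →L[𝕜] E) {f g : α → X} (hf : Continuous f) (hg : Continuous g) :
    Continuous fun r => e (f r) + a (g r) := by
  fun_prop

/-- Writing `f = a + A b` reduces strong continuity on `X₋₁` to that on `X`; local boundedness then
upgrades it to joint continuity. -/
lemma continuous_uncurry_extendedSemigroup {S : C0Semigroup 𝕜 X} {A : X →ₗ.[𝕜] X}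
    (hA : S.IsGenerator (-A)) :
    Continuous fun p : ℝ≥0 × Extrapolation A => extendedSemigroup hA p.1 p.2 := by
  refine continuous_uncurry_of_strong (fun r f => extendedSemigroup hA r f)
    (extendedSemigroup_sub hA) (fun f => ?_) fun R => ?_
  · obtain ⟨a, b, rfl⟩ := exists_eq_embed_add_extendedOp A f
    simp only [extendedSemigroup_add, extendedSemigroup_embed, extendedSemigroup_extendedOp]
    exact continuous_map_add_map (𝕜 := 𝕜) (E := Extrapolation A) (embedL A) (extendedOpL A)
      (S.continuous_op a) (S.continuous_op b)
  · obtain ⟨M, -, hM⟩ := S.exists_norm_op_le R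
    refine ⟨M, fun r hr f => (norm_extendedSemigroup_le hA r f).trans ?_⟩
    gcongr
    exact hM r hr

/-! ### The integrated semigroup and injectivity of `X → X₋₁` -/

section Integral

variable [NormedSpace ℝ X]

lemma C0Semigroup.continuous_orbit (S : C0Semigroup 𝕜 X) (x : X) :
    Continuous fun s : ℝ => S.op s.toNNReal x :=
  S.continuous_op_apply continuous_id continuous_const

/-- The operator `∫₀ʳ S(s) ds`. -/
noncomputable def C0Semigroup.integralOp (S : C0Semigroup 𝕜 X) (r : ℝ≥0) : X →L[𝕜] X :=
  LinearMap.mkContinuousOfExistsBound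
    { toFun := fun x => ∫ s in (0 : ℝ)..r, S.op s.toNNReal x
      map_add' := fun x y => by
        simp only [map_add]
        exact intervalIntegral.integral_add ((S.continuous_orbit x).intervalIntegrable _ _)
          ((S.continuous_orbit y).intervalIntegrable _ _)
      map_smul' := fun c x => by
        simp only [map_smul, RingHom.id_apply]
        exact ContinuousLinearMap.intervalIntegral_comp_comm
          (c • ContinuousLinearMap.id 𝕜 X) ((S.continuous_orbit x).intervalIntegrable _ _) } (by
    obtain ⟨M, -, hM⟩ := S.exists_norm_op_le r
    refine ⟨M * r, fun x => ?_⟩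
    refine (intervalIntegral.norm_integral_le_of_norm_le_const (C := M * ‖x‖)
      fun s hs => ?_).trans_eq ?_
    · rw [uIoc_of_le r.coe_nonneg] at hs
      exact (S.op _).le_of_opNorm_le (hM _ (Real.toNNReal_le_iff_le_coe.2 hs.2)) x
    · rw [sub_zero, NNReal.abs_eq]
      ring)

lemma C0Semigroup.integralOp_apply (S : C0Semigroup 𝕜 X) (r : ℝ≥0) (x : X) :
    S.integralOp r x = ∫ s in (0 : ℝ)..r, S.op s.toNNReal x := rfl

variable [IsScalarTower ℝ 𝕜 X]

/-- The generator supplies a right derivative of the orbit of `x`, namely the orbit of `y`; this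
suffices for the fundamental theorem of calculus. -/
lemma C0Semigroup.IsGenerator.integralOp_generator {S : C0Semigroup 𝕜 X} {G : X →ₗ.[𝕜] X}
    (hG : S.IsGenerator G) (r : ℝ≥0) {x y : X} (h : (x, y) ∈ G.graph) :
    S.integralOp r y = S.op r x - x := by
  have key : ∀ s : ℝ, 0 ≤ s → HasDerivWithinAt (fun s : ℝ => S.op s.toNNReal x)
      (S.op s.toNNReal y) (Ioi s) s := by
    intro s hs
    have h1 := (hG _ _).1 (hG.op_mem s.toNNReal h)
    rw [hasDerivWithinAt_iff_tendsto_slope' (by simp)]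
    have h2 : Tendsto (fun a : ℝ => (a - s).toNNReal) (𝓝[>] s) (𝓝[>] 0) := by
      refine tendsto_nhdsWithin_iff.2 ⟨?_, ?_⟩
      · have : Continuous fun a : ℝ => (a - s).toNNReal := by fun_prop
        exact (this.tendsto' s 0 (by simp)).mono_left nhdsWithin_le_nhds
      · filter_upwards [self_mem_nhdsWithin] with a ha
        simpa using ha
    refine (h1.comp h2).congr' ?_
    filter_upwards [self_mem_nhdsWithin] with a ha
    have ha' : 0 ≤ a - s := sub_nonneg.2 (le_of_lt ha)
    simp only [Function.comp, slope_def_module]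
    rw [Real.coe_toNNReal _ ha', RCLike.real_smul_eq_coe_smul (K := 𝕜), RCLike.ofReal_inv,
      ← ContinuousLinearMap.comp_apply, ← S.op_add, ← Real.toNNReal_add ha' hs, sub_add_cancel]
  have := intervalIntegral.integral_eq_sub_of_hasDeriv_right (a := 0) (b := r)
    (S.continuous_orbit x).continuousOn (fun s hs => key s ?_)
    ((S.continuous_orbit y).intervalIntegrable _ _)
  · rw [S.integralOp_apply, this]
    simp [S.op_zero]
  · rw [min_eq_left r.coe_nonneg] at hs
    exact hs.1.le

/-- `A ∫₀ʳ S(s) y ds = y - S(r) y` in `X₋₁`. -/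
lemma extendedOp_integralOp {S : C0Semigroup 𝕜 X} {A : X →ₗ.[𝕜] X}
    (hA : S.IsGenerator (-A)) (r : ℝ≥0) (y : X) :
    extendedOp A (S.integralOp r y) = embed A y - embed A (S.op r y) := by
  have hd : Dense (A.domain : Set X) := hA.dense
  ext p
  change inner 𝕜 p.1.2 (S.integralOp r y) = inner 𝕜 p.1.1 y - inner 𝕜 p.1.1 (S.op r y)
  have h : Continuous fun y => inner 𝕜 p.1.2 (S.integralOp r y) := by fun_prop
  have h' : Continuous fun y => inner 𝕜 p.1.1 y - inner 𝕜 p.1.1 (S.op r y) := by fun_prop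
  -- Both sides are continuous in `y`, so it is enough to take `y ∈ D(A)`, where `A` can be moved
  -- under the integral.
  refine congrFun (h.ext_on hd h' fun y hy => ?_) y
  obtain ⟨z, hz⟩ : ∃ z, (y, z) ∈ A.graph := ⟨A ⟨y, hy⟩, A.mem_graph ⟨y, hy⟩⟩
  have hz' := neg_mem_graph.1 hz
  have h1 := hA.integralOp_generator r hz'
  rw [map_neg, neg_eq_iff_eq_neg, neg_sub] at h1
  have h2 : ∀ s, inner 𝕜 p.1.2 (S.op s y) = inner 𝕜 p.1.1 (S.op s z) := fun s => by
    refine (mem_adjoint_graph A hd p.1).1 p.2 _ _ (neg_mem_graph.2 ?_)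
    rw [← map_neg]
    exact hA.op_mem s hz'
  simp only
  rw [← inner_sub_right, ← h1, ← innerSL_apply_apply 𝕜, ← innerSL_apply_apply 𝕜,
    S.integralOp_apply, S.integralOp_apply,
    ← ContinuousLinearMap.intervalIntegral_comp_comm _
      ((S.continuous_orbit y).intervalIntegrable _ _),
    ← ContinuousLinearMap.intervalIntegral_comp_comm _
      ((S.continuous_orbit z).intervalIntegrable _ _)]
  simp only [innerSL_apply_apply, h2]

/-- `D(A*)` separates the points of `X`, hence `X → X₋₁` is injective. -/
lemma embed_injective {S : C0Semigroup 𝕜 X} {A : X →ₗ.[𝕜] X}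
    (hA : S.IsGenerator (-A)) : Function.Injective (embed A) := by
  have hd : Dense (A.domain : Set X) := hA.dense
  refine (injective_iff_map_eq_zero (embedL A)).2 fun x hx => ?_
  have h0 : ∀ r : ℝ≥0, S.integralOp r x = 0 := by
    intro r
    refine ext_inner_left 𝕜 fun φ => ?_
    -- The adjoint form of `A ∫₀ʳ S = I - S(r)` puts `(∫₀ʳ S)* φ` in `D(A*)` for every `φ`. Testing
    -- `x` against these vectors gives `∫₀ʳ S(s)x ds = 0`, whose derivative at `r = 0` is `x`.
    have hmem : ((S.integralOp r).adjoint φ, φ - (S.op r).adjoint φ) ∈ A.adjoint.graph := by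
      refine (mem_adjoint_graph A hd _).2 fun y z hyz => ?_
      have h1 := hA.integralOp_generator r (neg_mem_graph.1 hyz)
      rw [map_neg, neg_eq_iff_eq_neg, neg_sub] at h1
      rw [ContinuousLinearMap.adjoint_inner_left, h1, inner_sub_left,
        ContinuousLinearMap.adjoint_inner_left, inner_sub_right]
    have h1 := congrArg (fun f : Extrapolation A => f ⟨_, hmem⟩) hx
    rw [inner_zero_right, ← ContinuousLinearMap.adjoint_inner_left]
    exact h1
  have h1 : HasDerivAt (fun t : ℝ => ∫ s in (0 : ℝ)..t, S.op s.toNNReal x)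
      (S.op (0 : ℝ).toNNReal x) 0 :=
    intervalIntegral.integral_hasDerivAt_right ((S.continuous_orbit x).intervalIntegrable _ _)
      ((S.continuous_orbit x).stronglyMeasurableAtFilter _ _) (S.continuous_orbit x).continuousAt
  have h2 : HasDerivWithinAt (fun t : ℝ => ∫ s in (0 : ℝ)..t, S.op s.toNNReal x) 0 (Ici 0) 0 := by
    refine (hasDerivWithinAt_const (0 : ℝ) (Ici 0) (0 : X)).congr (fun t ht => ?_) (by simp)
    have := h0 t.toNNReal
    rwa [S.integralOp_apply, Real.coe_toNNReal t ht] at this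
  have h3 := (uniqueDiffOn_Ici (0 : ℝ) 0 self_mem_Ici).eq_deriv _ h1.hasDerivWithinAt h2
  simpa [S.op_zero] using h3


/-- An extrapolation space of the semigroup `S`, with its embedding of `X`, the extension of the
negative of the generator of `S` and the extension of the semigroup. -/
structure ExtrapolationSpace (S : C0Semigroup 𝕜 X) (E : Type*) [NormedAddCommGroup E]
    [NormedSpace 𝕜 E] where
  /-- the embedding of the state space -/
  emb : X →L[𝕜] E
  /-- the extension of `A`, where `-A` generates `S` -/
  ext : X →L[𝕜] E
  /-- the extension of the semigroup -/
  op : ℝ≥0 → E →L[𝕜] E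
  emb_injective : Function.Injective emb
  op_emb : ∀ r x, op r (emb x) = emb (S.op r x)
  op_ext : ∀ r x, op r (ext x) = ext (S.op r x)
  continuous_op : Continuous fun p : ℝ≥0 × E => op p.1 p.2
  ext_integralOp : ∀ r x, ext (S.integralOp r x) = emb x - emb (S.op r x)

/-- `X₋₁` as an extrapolation space. -/
noncomputable def extrapolationSpace {S : C0Semigroup 𝕜 X} {A : X →ₗ.[𝕜] X}
    (hA : S.IsGenerator (-A)) : ExtrapolationSpace S (Extrapolation A) where
  emb := embedL A
  ext := extendedOpL A
  op t := LinearMap.mkContinuous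
    { toFun := extendedSemigroup hA t
      map_add' := extendedSemigroup_add hA t
      map_smul' := extendedSemigroup_smul hA t } ‖S.op t‖ (norm_extendedSemigroup_le hA t)
  emb_injective := embed_injective hA
  op_emb := extendedSemigroup_embed hA
  op_ext := extendedSemigroup_extendedOp hA
  continuous_op := continuous_uncurry_extendedSemigroup hA
  ext_integralOp := extendedOp_integralOp hA

end Integral

end Semigroup

/-! ### Duhamel's formula for regular states -/

namespace ExtrapolationSpace

variable {𝕜 X U E : Type*} [RCLike 𝕜]
  [NormedAddCommGroup X] [InnerProductSpace 𝕜 X] [CompleteSpace X]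
  [NormedAddCommGroup U] [InnerProductSpace 𝕜 U] [CompleteSpace U]
  [NormedAddCommGroup E] [NormedSpace 𝕜 E] [CompleteSpace E]
  [NormedSpace ℝ X] [IsScalarTower ℝ 𝕜 X]
  [NormedSpace ℝ E] [IsScalarTower ℝ 𝕜 E]
  {S : C0Semigroup 𝕜 X} (P : ExtrapolationSpace S E)

lemma continuous_op_apply {α : Type*} [TopologicalSpace α]
    {r : α → ℝ} {f : α → E} (hr : Continuous r) (hf : Continuous f) :
    Continuous fun a => P.op (r a).toNNReal (f a) :=
  P.continuous_op.comp ((continuous_real_toNNReal.comp hr).prodMk hf)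

/-- The orbits are differentiable in `X₋₁`. -/
lemma hasDerivAt_emb_op (x : X) {r : ℝ} (hr : 0 < r) :
    HasDerivAt (fun r : ℝ => P.emb (S.op r.toNNReal x)) (-P.ext (S.op r.toNNReal x)) r := by
  have h1 : HasDerivAt (fun t : ℝ => ∫ s in (0 : ℝ)..t, P.ext (S.op s.toNNReal x))
      (P.ext (S.op r.toNNReal x)) r := by
    have hc : Continuous fun s : ℝ => P.ext (S.op s.toNNReal x) :=
      P.ext.continuous.comp (S.continuous_orbit x)
    exact intervalIntegral.integral_hasDerivAt_right (hc.intervalIntegrable _ _)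
      (hc.stronglyMeasurableAtFilter _ _) hc.continuousAt
  refine (h1.const_sub (P.emb x)).congr_of_eventuallyEq ?_
  filter_upwards [lt_mem_nhds hr] with t ht
  have h2 := P.ext_integralOp t.toNNReal x
  rw [ContinuousLinearMap.intervalIntegral_comp_comm _
      ((S.continuous_orbit x).intervalIntegrable _ _)]
  rw [S.integralOp_apply, Real.coe_toNNReal t ht.le] at h2
  rw [h2]
  abel

/-- Duhamel's formula for a regular state `Y`. -/
lemma duhamel {Y y : ℝ → X} (hY : ∀ t, HasDerivAt Y (y t) t) (hy : Continuous y)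
    {t : ℝ} (ht : 0 ≤ t) :
    ∫ s in (0 : ℝ)..t, P.op (t - s).toNNReal (P.emb (y s) + P.ext (Y s)) =
      P.emb (Y t) - P.emb (S.op t.toNNReal (Y 0)) := by
  have hYc : Continuous Y := continuous_iff_continuousAt.2 fun t => (hY t).continuousAt
  have hk : Continuous fun s => P.emb (S.op (t - s).toNNReal (Y s)) :=
    P.emb.continuous.comp (S.continuous_op_apply (by fun_prop) hYc)
  have hint : Continuous fun s => P.op (t - s).toNNReal (P.emb (y s) + P.ext (Y s)) :=
    P.continuous_op_apply (by fun_prop) (by fun_prop)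
  rw [intervalIntegral.integral_eq_sub_of_hasDeriv_right hk.continuousOn (fun s hs => ?_)
    (hint.intervalIntegrable _ _)]
  · simp [S.op_zero]
  rw [min_eq_left ht, max_eq_right ht] at hs
  refine HasDerivAt.hasDerivWithinAt ?_
  rw [map_add, P.op_emb, P.op_ext]
  -- Product rule for `S(t - a) Y(a)` through `Y a = (Y a - Y s) + Y s`. The first part converges by
  -- joint continuity of the semigroup applied to difference quotients; the second is an orbit,
  -- differentiated in the larger space `E`.
  have h1 : HasDerivAt (fun a => P.emb (S.op (t - a).toNNReal (Y a - Y s)))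
      (P.emb (S.op (t - s).toNNReal (y s))) s := by
    rw [hasDerivAt_iff_tendsto_slope]
    have h := hasDerivAt_iff_tendsto_slope.1 (hY s)
    have h2 : Tendsto (fun a => (t - a).toNNReal) (𝓝[≠] s) (𝓝 (t - s).toNNReal) :=
      (Continuous.tendsto (by fun_prop) s).mono_left nhdsWithin_le_nhds
    have h3 := (P.emb.continuous.comp S.continuous_uncurry).continuousAt.tendsto.comp
      (h2.prodMk_nhds h)
    refine h3.congr fun a => ?_
    simp only [Function.comp, slope_def_module, sub_self, map_zero, sub_zero]
    rw [RCLike.real_smul_eq_coe_smul (K := 𝕜), RCLike.real_smul_eq_coe_smul (K := 𝕜), map_smul,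
      map_smul]
  have h2 : HasDerivAt (fun a => P.emb (S.op (t - a).toNNReal (Y s)))
      (P.ext (S.op (t - s).toNNReal (Y s))) s := by
    have h := (P.hasDerivAt_emb_op (Y s) (sub_pos.2 hs.2)).scomp s
      ((hasDerivAt_id s).const_sub t)
    simpa [Function.comp_def] using h
  refine (h1.add h2).congr_of_eventuallyEq (Eventually.of_forall fun a => ?_)
  simp only [Pi.add_apply]
  rw [← map_add, ← map_add, sub_add_cancel]

end ExtrapolationSpace

/-! ### `L²` estimates for moving averages -/

section Averages

variable {F : Type*} [NormedAddCommGroup F]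

lemma eLpNorm_two_sq {α : Type*} [MeasurableSpace α] (μ : Measure α) (f : α → F) :
    eLpNorm f 2 μ ^ 2 = ∫⁻ x, ‖f x‖ₑ ^ 2 ∂μ := by
  have := eLpNorm_nnreal_pow_eq_lintegral (f := f) (μ := μ) (p := 2) (by norm_num)
  simpa using this

/-- Moving averages do not increase the `L²`-norm. -/
lemma eLpNorm_integral_sub_le [NormedSpace ℝ F] {g : ℝ → F} (hg : StronglyMeasurable g) {δ : ℝ}
    (hδ : 0 ≤ δ) :
    eLpNorm (fun t => ∫ s in (t - δ)..t, g s) 2 volume ≤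
      ENNReal.ofReal δ * eLpNorm g 2 volume := by
  have hm : ∀ t, StronglyMeasurable fun r => g (t - r) := fun t =>
    hg.comp_measurable (measurable_const.sub measurable_id)
  -- Cauchy–Schwarz on a window of length `δ` yields one factor `δ`; Tonelli and translation
  -- invariance yield the second.
  have h1 : ∀ t, ‖∫ s in (t - δ)..t, g s‖ₑ ^ 2 ≤
      ENNReal.ofReal δ * ∫⁻ r in Ioc 0 δ, ‖g (t - r)‖ₑ ^ 2 := by
    intro t
    have h2 : ∫ s in (t - δ)..t, g s = ∫ r in Ioc 0 δ, g (t - r) := by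
      have := intervalIntegral.integral_comp_sub_left (a := 0) (b := δ) g t
      rw [sub_zero] at this
      rw [← this, intervalIntegral.integral_of_le hδ]
    have h3 : ‖∫ s in (t - δ)..t, g s‖ₑ ≤ eLpNorm (fun r => g (t - r)) 2
        (volume.restrict (Ioc 0 δ)) * ENNReal.ofReal δ ^ (1 / 2 : ℝ) := by
      rw [h2]
      refine (enorm_integral_le_lintegral_enorm _).trans ?_
      rw [← eLpNorm_one_eq_lintegral_enorm]
      refine (eLpNorm_le_eLpNorm_mul_rpow_measure_univ (q := 2) (by norm_num)
        (hm t).aestronglyMeasurable).trans_eq ?_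
      congr 2
      · simp
      · norm_num
    calc _ ≤ (eLpNorm (fun r => g (t - r)) 2
        (volume.restrict (Ioc 0 δ)) * ENNReal.ofReal δ ^ (1 / 2 : ℝ)) ^ 2 := by gcongr
      _ = _ := by
        rw [mul_pow, eLpNorm_two_sq, mul_comm]
        congr 1
        rw [← ENNReal.rpow_natCast, ← ENNReal.rpow_mul]
        norm_num
  have hmeas : Measurable (Function.uncurry fun t r : ℝ => ‖g (t - r)‖ₑ ^ 2) :=
    ((hg.comp_measurable (measurable_fst.sub measurable_snd)).enorm).pow_const 2
  refine (ENNReal.pow_le_pow_left_iff two_ne_zero).1 ?_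
  rw [mul_pow, eLpNorm_two_sq, eLpNorm_two_sq]
  calc ∫⁻ t, ‖∫ s in (t - δ)..t, g s‖ₑ ^ 2
      ≤ ∫⁻ t, ENNReal.ofReal δ * ∫⁻ r in Ioc 0 δ, ‖g (t - r)‖ₑ ^ 2 := lintegral_mono h1
    _ = ENNReal.ofReal δ * ∫⁻ t, ∫⁻ r in Ioc 0 δ, ‖g (t - r)‖ₑ ^ 2 :=
      lintegral_const_mul' _ _ ENNReal.ofReal_ne_top
    _ = ENNReal.ofReal δ * ∫⁻ r in Ioc 0 δ, ∫⁻ t, ‖g (t - r)‖ₑ ^ 2 := by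
      rw [lintegral_lintegral_swap hmeas.aemeasurable]
    _ = ENNReal.ofReal δ ^ 2 * ∫⁻ t, ‖g t‖ₑ ^ 2 := by
      simp_rw [lintegral_sub_right_eq_self (fun t => ‖g t‖ₑ ^ 2)]
      rw [setLIntegral_const, Real.volume_Ioc, sub_zero]
      ring

/-- On a finite measure space, the `L¹`-norm is bounded by the `L²`-norm. -/
lemma exists_integral_norm_le {α : Type*} [MeasurableSpace α] (μ : Measure α) [IsFiniteMeasure μ] :
    ∃ C : ℝ, 0 ≤ C ∧ ∀ u : Lp F 2 μ, ∫ s, ‖u s‖ ∂μ ≤ C * ‖u‖ := by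
  refine ⟨(μ univ ^ (1 / 2 : ℝ)).toReal, ENNReal.toReal_nonneg, fun u => ?_⟩
  rw [integral_norm_eq_lintegral_enorm (Lp.aestronglyMeasurable u),
    ← eLpNorm_one_eq_lintegral_enorm, Lp.norm_def, mul_comm, ← ENNReal.toReal_mul]
  refine ENNReal.toReal_mono (ENNReal.mul_ne_top (Lp.eLpNorm_ne_top u)
    (ENNReal.rpow_ne_top_of_nonneg (by norm_num) (measure_ne_top μ _))) ?_
  refine (eLpNorm_le_eLpNorm_mul_rpow_measure_univ (q := 2) (by norm_num)
    (Lp.aestronglyMeasurable u)).trans_eq ?_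
  norm_num

lemma integral_eq_zero_of_nonpos [NormedSpace ℝ F] {f : ℝ → F} (hf : ∀ t ≤ 0, f t = 0) (t : ℝ)
    (ht : t ≤ 0) : ∫ s in (0 : ℝ)..t, f s = 0 := by
  rw [intervalIntegral.integral_congr (g := fun _ => 0), intervalIntegral.integral_zero]
  intro s hs
  rw [uIcc_of_ge ht] at hs
  exact hf s hs.2

end Averages

/-! ### From admissibility to bounds on the state -/

namespace ExtrapolationSpace

variable {𝕜 X U E : Type*} [RCLike 𝕜]
  [NormedAddCommGroup X] [InnerProductSpace 𝕜 X] [CompleteSpace X]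
  [NormedAddCommGroup U] [InnerProductSpace 𝕜 U] [CompleteSpace U]
  [NormedAddCommGroup E] [NormedSpace 𝕜 E] [CompleteSpace E]
  [NormedSpace ℝ E] [NormedSpace ℝ X]
  {S : C0Semigroup 𝕜 X} (P : ExtrapolationSpace S E) (B : U →L[𝕜] E)

/-- The extended semigroup is locally bounded. -/
lemma exists_norm_op_le (R : ℝ≥0) : ∃ M : ℝ, 0 ≤ M ∧ ∀ r ≤ R, ‖P.op r‖ ≤ M := by
  obtain ⟨C, hC⟩ := banach_steinhaus (g := fun r : Icc (0 : ℝ≥0) R => P.op r) fun x => by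
    obtain ⟨C, hC⟩ := (isCompact_Icc (a := (0 : ℝ≥0)) (b := R)).exists_bound_of_continuousOn
      (P.continuous_op.comp (continuous_id.prodMk (continuous_const (y := x)))).continuousOn
    exact ⟨C, fun i => hC i i.2⟩
  exact ⟨max C 0, le_max_right _ _, fun r hr => (hC ⟨r, bot_le, hr⟩).trans (le_max_left _ _)⟩

lemma aestronglyMeasurable_op {μ : Measure ℝ} {u : ℝ → U} (hu : AEStronglyMeasurable u μ) (τ : ℝ) :
    AEStronglyMeasurable (fun s => P.op (τ - s).toNNReal (B (u s))) μ := by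
  have h1 : Continuous fun s : ℝ => (τ - s).toNNReal := by fun_prop
  exact P.continuous_op.comp_aestronglyMeasurable
    (h1.aestronglyMeasurable.prodMk (B.continuous.comp_aestronglyMeasurable hu))

/-- The input map in the extrapolation space is well defined and bounded. -/
lemma exists_norm_input_le (τ : ℝ) : ∃ C : ℝ, ∀ u : L2 U τ,
    Integrable (fun s => P.op (τ - s).toNNReal (B (u s))) (volume.restrict (Ioo 0 τ)) ∧
    ‖∫ s in Ioo 0 τ, P.op (τ - s).toNNReal (B (u s))‖ ≤ C * ‖u‖ := by
  obtain ⟨M, hM0, hM⟩ := P.exists_norm_op_le τ.toNNReal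
  obtain ⟨c, hc0, hc⟩ := exists_integral_norm_le (F := U) (volume.restrict (Ioo (0 : ℝ) τ))
  refine ⟨M * ‖B‖ * c, fun u => ?_⟩
  have hu : Integrable (fun s => M * ‖B‖ * ‖u s‖) (volume.restrict (Ioo 0 τ)) :=
    ((Lp.memLp u).integrable (by norm_num)).norm.const_mul _
  have hle : ∀ᵐ s ∂volume.restrict (Ioo 0 τ),
      ‖P.op (τ - s).toNNReal (B (u s))‖ ≤ M * ‖B‖ * ‖u s‖ := by
    filter_upwards [ae_restrict_mem measurableSet_Ioo] with s hs
    rw [mul_assoc]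
    refine (P.op _).le_of_opNorm_le_of_le (hM _ (Real.toNNReal_le_toNNReal ?_)) (B.le_opNorm _)
    linarith [hs.1]
  have hint := hu.mono' (P.aestronglyMeasurable_op B (Lp.aestronglyMeasurable u) τ) hle
  refine ⟨hint, (norm_integral_le_of_norm_le hu hle).trans ?_⟩
  rw [integral_const_mul, mul_assoc (M * ‖B‖)]
  gcongr
  exact hc u

/-- For an admissible control operator, the input map is bounded with values in the state space. -/
lemma exists_norm_le_of_emb_eq_input {τ : ℝ}
    (hadm : ∀ u : L2 U τ, ∃ z, P.emb z = ∫ s in Ioo 0 τ, P.op (τ - s).toNNReal (B (u s))) :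
    ∃ C : ℝ, 0 ≤ C ∧ ∀ (u : L2 U τ) (z : X),
      P.emb z = ∫ s in Ioo 0 τ, P.op (τ - s).toNNReal (B (u s)) → ‖z‖ ≤ C * ‖u‖ := by
  obtain ⟨K, hK⟩ := P.exists_norm_input_le B τ
  choose Ψ hΨ using hadm
  have hadd : ∀ u v : L2 U τ, ∫ s in Ioo 0 τ, P.op (τ - s).toNNReal (B ((u + v : L2 U τ) s)) =
      (∫ s in Ioo 0 τ, P.op (τ - s).toNNReal (B (u s))) +
        ∫ s in Ioo 0 τ, P.op (τ - s).toNNReal (B (v s)) := by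
    intro u v
    rw [← integral_add (hK u).1 (hK v).1]
    refine integral_congr_ae ?_
    filter_upwards [Lp.coeFn_add u v] with s hs
    rw [hs, Pi.add_apply, map_add, map_add]
  let L : L2 U τ →ₗ[𝕜] X :=
    { toFun := Ψ
      map_add' := fun u v => P.emb_injective (by rw [map_add, hΨ, hΨ, hΨ, hadd])
      map_smul' := fun c u => P.emb_injective (by
        rw [RingHom.id_apply, map_smul, hΨ, hΨ]
        have h := ContinuousLinearMap.integral_comp_comm
          (c • ContinuousLinearMap.id 𝕜 E) (hK u).1
        rw [_root_.smul_apply, ContinuousLinearMap.id_apply] at h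
        rw [← h]
        refine integral_congr_ae ?_
        filter_upwards [Lp.coeFn_smul c u] with s hs
        rw [hs, Pi.smul_apply, map_smul, map_smul]
        rfl) }
  -- Closed graph theorem: the input map is bounded into `E` and `P.emb` is continuous and
  -- injective, so the graph of the `X`-valued map is closed.
  have hL : Continuous L := by
    refine L.continuous_of_seq_closed_graph fun u v y hu hy => P.emb_injective ?_
    have h1 := (P.emb.continuous.tendsto y).comp hy
    refine tendsto_nhds_unique h1 (tendsto_iff_norm_sub_tendsto_zero.2 ?_)
    have h2 : Tendsto (fun n => K * ‖u n - v‖) atTop (𝓝 0) := by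
      simpa using (tendsto_iff_norm_sub_tendsto_zero.1 hu).const_mul K
    refine squeeze_zero (fun _ => norm_nonneg _) (fun n => ?_) h2
    simp only [Function.comp]
    rw [← map_sub, ← map_sub]
    exact (congrArg norm (hΨ (u n - v))).trans_le (hK _).2
  refine ⟨‖(⟨L, hL⟩ : L2 U τ →L[𝕜] X)‖, norm_nonneg _, fun u z hz => ?_⟩
  have : z = L u := P.emb_injective (hz.trans (hΨ u).symm)
  rw [this]
  exact (⟨L, hL⟩ : L2 U τ →L[𝕜] X).le_opNorm u

variable [IsScalarTower ℝ 𝕜 X] [IsScalarTower ℝ 𝕜 E] [NormedSpace ℝ U]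

/-- Regular states are bounded by the `L²`-norm of the control. -/
lemma exists_norm_le_of_regular {τ : ℝ} (hτ : 0 < τ)
    (hadm : ∀ u : L2 U τ, ∃ z, P.emb z = ∫ s in Ioo 0 τ, P.op (τ - s).toNNReal (B (u s)))
    (n : ℕ) : ∃ C : ℝ, 0 ≤ C ∧ ∀ (T : ℝ) (Y y : ℝ → X) (W : ℝ → U),
      (∀ t, HasDerivAt Y (y t) t) → Continuous y → MemLp W 2 volume →
      (∀ t ≤ T, P.emb (y t) + P.ext (Y t) = B (W t)) → (∀ t ≤ 0, Y t = 0) →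
      ∀ t ≤ T, t ≤ n * τ → ‖Y t‖ ≤ C * (eLpNorm W 2 volume).toReal := by
  obtain ⟨K, hK0, hK⟩ := P.exists_norm_le_of_emb_eq_input B hadm
  -- Admissibility concerns one duration `τ`, so go back from `t` in steps of length `τ` until the
  -- time is nonpositive, where `Y` vanishes. Each step costs the input bound `K` and the norm of
  -- `S(τ)`.
  induction n with
  | zero =>
    refine ⟨0, le_rfl, fun T Y y W _ _ _ _ h0 t _ ht => ?_⟩
    rw [h0 t (by simpa using ht)]
    simp
  | succ n ih =>
    obtain ⟨C, hC0, hC⟩ := ih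
    refine ⟨K + ‖S.op τ.toNNReal‖ * C, by positivity, fun T Y y W hY hy hW heq h0 t htT ht => ?_⟩
    have hprev := hC T Y y W hY hy hW heq h0 (t - τ) (by linarith) (by push_cast at ht; linarith)
    have hmp := measurePreserving_add_right (volume : Measure ℝ) (t - τ)
    have hW' : MemLp (fun s => W (s + (t - τ))) 2 volume := hW.comp_measurePreserving hmp
    have hW2 := hW'.restrict (Ioo 0 τ)
    -- Duhamel on the window `[t - τ, t]`, translated to `[0, τ]`. The window may reach into
    -- negative times, where the equation is assumed as well.
    have hd := P.duhamel (Y := fun s => Y (s + (t - τ))) (y := fun s => y (s + (t - τ)))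
      (fun s => (hY (s + (t - τ))).comp_add_const s (t - τ)) (by fun_prop) hτ.le
    have hz := hK (hW2.toLp _) (Y t - S.op τ.toNNReal (Y (t - τ))) (by
      rw [map_sub]
      simp only [zero_add, add_sub_cancel] at hd
      rw [← hd, intervalIntegral.integral_of_le hτ.le, integral_Ioc_eq_integral_Ioo]
      refine integral_congr_ae ?_
      filter_upwards [hW2.coeFn_toLp, ae_restrict_mem measurableSet_Ioo] with s hs hs'
      rw [hs, heq _ (by linarith [hs'.2])])
    rw [Lp.norm_toLp] at hz
    have hle : (eLpNorm (fun s => W (s + (t - τ))) 2 (volume.restrict (Ioo 0 τ))).toReal ≤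
        (eLpNorm W 2 volume).toReal := by
      refine ENNReal.toReal_mono hW.2.ne ((eLpNorm_mono_measure _ Measure.restrict_le_self).trans_eq
        (eLpNorm_comp_measurePreserving hW.1 hmp))
    calc ‖Y t‖ = ‖(Y t - S.op τ.toNNReal (Y (t - τ))) + S.op τ.toNNReal (Y (t - τ))‖ := by
          rw [sub_add_cancel]
      _ ≤ ‖Y t - S.op τ.toNNReal (Y (t - τ))‖ + ‖S.op τ.toNNReal (Y (t - τ))‖ := norm_add_le _ _
      _ ≤ K * (eLpNorm W 2 volume).toReal +
          ‖S.op τ.toNNReal‖ * (C * (eLpNorm W 2 volume).toReal) := by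
        refine add_le_add (hz.trans (by gcongr)) ((S.op _).le_opNorm_of_le hprev)
      _ = _ := by ring

/-- States that start at `0` are bounded by the `L²`-norm of the control. -/
lemma exists_norm_le_of_integral_eq [IsScalarTower ℝ 𝕜 U] {τ : ℝ} (hτ : 0 < τ)
    (hadm : ∀ u : L2 U τ, ∃ z, P.emb z = ∫ s in Ioo 0 τ, P.op (τ - s).toNNReal (B (u s)))
    (T : ℝ) : ∃ C : ℝ, 0 ≤ C ∧ ∀ (x : ℝ → X) (g : ℝ → U),
      Continuous x → (∀ t ≤ 0, x t = 0) → StronglyMeasurable g → Integrable g →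
      MemLp g 2 volume → (∀ t ≤ 0, g t = 0) →
      (∀ t ∈ Icc 0 T, P.emb (x t) + P.ext (∫ s in (0 : ℝ)..t, x s) =
        B (∫ s in (0 : ℝ)..t, g s)) →
      ∀ t ∈ Icc 0 T, ‖x t‖ ≤ C * (eLpNorm g 2 volume).toReal := by
  obtain ⟨n, hn⟩ := exists_nat_ge (T / τ)
  rw [div_le_iff₀ hτ] at hn
  obtain ⟨C, hC0, hC⟩ := P.exists_norm_le_of_regular B hτ hadm n
  refine ⟨C, hC0, fun x g hx hx0 hgm hgi hg hg0 heq t ht => ?_⟩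
  set X' : ℝ → X := fun t => ∫ s in (0 : ℝ)..t, x s with hX'
  set V : ℝ → U := fun t => ∫ s in (0 : ℝ)..t, g s with hV
  have hXd : ∀ t, HasDerivAt X' (x t) t := fun t =>
    intervalIntegral.integral_hasDerivAt_right (hx.intervalIntegrable _ _)
      (hx.stronglyMeasurableAtFilter _ _) hx.continuousAt
  have hX0 : ∀ t ≤ 0, X' t = 0 := integral_eq_zero_of_nonpos hx0
  have hV0 : ∀ t ≤ 0, V t = 0 := integral_eq_zero_of_nonpos hg0
  have heq' : ∀ t ≤ T, P.emb (x t) + P.ext (X' t) = B (V t) := by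
    intro t ht
    rcases le_total t 0 with h | h
    · simp [hx0 t h, hX0 t h, hV0 t h]
    · exact heq t ⟨h, ht⟩
  have hVc : Continuous V := intervalIntegral.continuous_primitive
    (fun a b => hgi.intervalIntegrable) 0
  -- The primitive `X'` is a regular state driven by `V`, hence so is its backward difference,
  -- driven by a moving integral of `g` of norm at most `δ‖g‖`. Dividing by `δ` and letting `δ → 0`
  -- bounds `x t` without Duhamel's formula for `x` itself.
  have key : ∀ δ : ℝ, 0 < δ → ‖X' t - X' (t - δ)‖ ≤ C * (δ * (eLpNorm g 2 volume).toReal) := by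
    intro δ hδ
    have hW : (fun t => V t - V (t - δ)) = fun t => ∫ s in (t - δ)..t, g s := by
      funext t
      exact intervalIntegral.integral_interval_sub_left hgi.intervalIntegrable
        hgi.intervalIntegrable
    have hle := eLpNorm_integral_sub_le hgm hδ.le
    rw [← hW] at hle
    have htop : ENNReal.ofReal δ * eLpNorm g 2 volume < ⊤ :=
      ENNReal.mul_lt_top ENNReal.ofReal_lt_top hg.2
    have hWc : Continuous fun t => V t - V (t - δ) := by fun_prop
    refine (hC T (fun t => X' t - X' (t - δ)) (fun t => x t - x (t - δ))
      (fun t => V t - V (t - δ)) (fun s => (hXd s).sub ((hXd (s - δ)).comp_sub_const s δ))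
      (by fun_prop) ⟨hWc.aestronglyMeasurable, hle.trans_lt htop⟩ (fun s hs => ?_)
      (fun s hs => ?_) t ht.2 (ht.2.trans hn)).trans ?_
    · rw [map_sub, map_sub, map_sub, ← heq' s hs, ← heq' (s - δ) (by linarith)]
      abel
    · rw [hX0 s hs, hX0 (s - δ) (by linarith), sub_zero]
    · gcongr
      refine (ENNReal.toReal_mono htop.ne hle).trans_eq ?_
      rw [ENNReal.toReal_mul, ENNReal.toReal_ofReal hδ.le]
  -- Negative increments `r = -δ` match the backward differences in `key`.
  have hlim := (hasDerivAt_iff_tendsto_slope_zero.1 (hXd t)).mono_left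
    (nhdsWithin_mono (s := Iio (0 : ℝ)) 0 fun r hr => ne_of_lt hr)
  refine le_of_tendsto hlim.norm ?_
  filter_upwards [self_mem_nhdsWithin] with r hr
  have hr' : 0 < -r := neg_pos.2 hr
  have h := key (-r) hr'
  rw [sub_neg_eq_add, norm_sub_rev] at h
  rw [norm_smul, norm_inv, Real.norm_eq_abs, abs_of_neg hr, inv_mul_le_iff₀ hr']
  refine h.trans_eq (by ring)

end ExtrapolationSpace

/-! ### Integrals of controls on bounded intervals -/

section IntervalControls

variable {F : Type*} [NormedAddCommGroup F]

lemma L2.integrableOn {T : ℝ} (u : L2 F T) : IntegrableOn u (Ioo 0 T) :=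
  (Lp.memLp u).integrable (by norm_num)

lemma intervalIntegrable_of_integrableOn_Ioo {T t : ℝ} {u : ℝ → F} (hu : IntegrableOn u (Ioo 0 T))
    (ht : t ∈ Icc 0 T) : IntervalIntegrable u volume 0 t :=
  (intervalIntegrable_iff_integrableOn_Ioo_of_le ht.1).2
    (hu.mono_set (Ioo_subset_Ioo_right ht.2))

lemma intervalIntegral_congr_ae_Ioo [NormedSpace ℝ F] {T t : ℝ} {u v : ℝ → F}
    (h : u =ᵐ[volume.restrict (Ioo 0 T)] v) (ht : t ∈ Icc 0 T) :
    ∫ s in (0 : ℝ)..t, u s = ∫ s in (0 : ℝ)..t, v s := by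
  rw [intervalIntegral.integral_of_le ht.1, intervalIntegral.integral_of_le ht.1,
    integral_Ioc_eq_integral_Ioo, integral_Ioc_eq_integral_Ioo]
  exact integral_congr_ae (ae_restrict_of_ae_restrict_of_subset (Ioo_subset_Ioo_right ht.2) h)

lemma ae_restrict_Ioo_of_split {a b c : ℝ} {p : ℝ → Prop}
    (h1 : ∀ᵐ t ∂volume.restrict (Ioo a b), p t) (h2 : ∀ᵐ t ∂volume.restrict (Ioo b c), p t) :
    ∀ᵐ t ∂volume.restrict (Ioo a c), p t := by
  rw [ae_restrict_iff' measurableSet_Ioo] at *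
  filter_upwards [h1, h2, Measure.ae_ne volume b] with t h1 h2 hne ht
  rcases lt_or_gt_of_ne hne with h | h
  · exact h1 ⟨ht.1, h⟩
  · exact h2 ⟨h, ht.2⟩

lemma L2.exists_norm_integral_le [NormedSpace ℝ F] (T : ℝ) : ∃ C : ℝ, ∀ u : L2 F T,
    ∀ t ∈ Icc 0 T, ‖∫ s in (0 : ℝ)..t, u s‖ ≤ C * ‖u‖ := by
  obtain ⟨C, -, hC⟩ := exists_integral_norm_le (F := F) (volume.restrict (Ioo (0 : ℝ) T))
  refine ⟨C, fun u t ht => le_trans ?_ (hC u)⟩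
  rw [intervalIntegral.integral_of_le ht.1, integral_Ioc_eq_integral_Ioo]
  exact (norm_integral_le_integral_norm _).trans (setIntegral_mono_set (L2.integrableOn u).norm
    (Eventually.of_forall fun _ => norm_nonneg _) (Ioo_subset_Ioo_right ht.2).eventuallyLE)

end IntervalControls

/-! ### States, superposition and null controls -/

namespace ExtrapolationSpace

variable {𝕜 X U E : Type*} [RCLike 𝕜]
  [NormedAddCommGroup X] [InnerProductSpace 𝕜 X] [CompleteSpace X]
  [NormedAddCommGroup U] [InnerProductSpace 𝕜 U] [CompleteSpace U]
  [NormedAddCommGroup E] [NormedSpace 𝕜 E] [CompleteSpace E]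
  [NormedSpace ℝ E] [NormedSpace ℝ X] [NormedSpace ℝ U]
  [IsScalarTower ℝ 𝕜 X] [IsScalarTower ℝ 𝕜 E] [IsScalarTower ℝ 𝕜 U]
  {S : C0Semigroup 𝕜 X} (P : ExtrapolationSpace S E) (B : U →L[𝕜] E)

/-- The function `x` is the state on `[0, T]` for the initial value `x₀` and the control `u`. -/
def IsState (T : ℝ) (x₀ : X) (u : ℝ → U) (x : ℝ → X) : Prop :=
  ContinuousOn x (Icc 0 T) ∧ x 0 = x₀ ∧
    ∀ t ∈ Icc (0 : ℝ) T, P.emb (x t) + P.ext (∫ s in (0 : ℝ)..t, x s) =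
      P.emb x₀ + B (∫ s in (0 : ℝ)..t, u s)

lemma intervalIntegrable_of_continuousOn {T t : ℝ} {x : ℝ → X} (hx : ContinuousOn x (Icc 0 T))
    (ht : t ∈ Icc 0 T) : IntervalIntegrable x volume 0 t :=
  (hx.mono (Icc_subset_Icc_right ht.2)).intervalIntegrable_of_Icc ht.1

variable {P B} {T : ℝ} {x₀ y₀ : X} {x y : ℝ → X}

/-- Bounded operators commute with the Bochner integral. The form with `P.ext` outside exhibits `∫
x` as a continuously differentiable state driven by `∫ u`. -/
lemma isState_iff {u : ℝ → U} (hu : IntegrableOn u (Ioo 0 T)) :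
    P.IsState B T x₀ u x ↔ ContinuousOn x (Icc 0 T) ∧ x 0 = x₀ ∧
      ∀ t ∈ Icc (0 : ℝ) T,
        P.emb (x t) = P.emb x₀ + ∫ s in (0 : ℝ)..t, (B (u s) - P.ext (x s)) := by
  refine and_congr_right fun hx => and_congr_right fun _ => forall₂_congr fun t ht => ?_
  have h1 := intervalIntegrable_of_integrableOn_Ioo hu ht
  have h2 := intervalIntegrable_of_continuousOn hx ht
  have h1' : IntervalIntegrable (fun s => B (u s)) volume 0 t :=
    ⟨B.integrable_comp h1.1, B.integrable_comp h1.2⟩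
  have h2' : IntervalIntegrable (fun s => P.ext (x s)) volume 0 t :=
    ⟨P.ext.integrable_comp h2.1, P.ext.integrable_comp h2.2⟩
  rw [intervalIntegral.integral_sub h1' h2', B.intervalIntegral_comp_comm h1,
    P.ext.intervalIntegral_comp_comm h2, ← add_sub_assoc, eq_sub_iff_add_eq]

lemma IsState.congr {u v : ℝ → U} (h : P.IsState B T x₀ u x)
    (huv : u =ᵐ[volume.restrict (Ioo 0 T)] v) : P.IsState B T x₀ v x :=
  ⟨h.1, h.2.1, fun t ht => by rw [h.2.2 t ht, intervalIntegral_congr_ae_Ioo huv ht]⟩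

lemma IsState.mono {u : ℝ → U} (h : P.IsState B T x₀ u x) {T' : ℝ} (hT : T' ≤ T) :
    P.IsState B T' x₀ u x :=
  ⟨h.1.mono (Icc_subset_Icc_right hT), h.2.1, fun t ht => h.2.2 t ⟨ht.1, ht.2.trans hT⟩⟩

lemma IsState.add {u v : L2 U T} (h : P.IsState B T x₀ u x) (h' : P.IsState B T y₀ v y) :
    P.IsState B T (x₀ + y₀) (u + v : L2 U T) (fun t => x t + y t) := by
  refine ⟨h.1.add h'.1, by simp only [h.2.1, h'.2.1], fun t ht => ?_⟩
  rw [intervalIntegral_congr_ae_Ioo (Lp.coeFn_add u v) ht]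
  simp only [Pi.add_apply]
  rw [intervalIntegral.integral_add (intervalIntegrable_of_continuousOn h.1 ht)
    (intervalIntegrable_of_continuousOn h'.1 ht), intervalIntegral.integral_add
    (intervalIntegrable_of_integrableOn_Ioo (L2.integrableOn u) ht)
    (intervalIntegrable_of_integrableOn_Ioo (L2.integrableOn v) ht), map_add, map_add, map_add,
    map_add, add_add_add_comm, h.2.2 t ht, h'.2.2 t ht, add_add_add_comm]

lemma IsState.smul {u : L2 U T} (c : 𝕜) (h : P.IsState B T x₀ u x) :
    P.IsState B T (c • x₀) (c • u : L2 U T) (fun t => c • x t) := by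
  refine ⟨h.1.const_smul c, by simp only [h.2.1], fun t ht => ?_⟩
  have h1 := (c • ContinuousLinearMap.id 𝕜 X).intervalIntegral_comp_comm
    (intervalIntegrable_of_continuousOn h.1 ht)
  have h2 := (c • ContinuousLinearMap.id 𝕜 U).intervalIntegral_comp_comm
    (intervalIntegrable_of_integrableOn_Ioo (L2.integrableOn u) ht)
  rw [intervalIntegral_congr_ae_Ioo (Lp.coeFn_smul c u) ht]
  simp only [_root_.smul_apply, ContinuousLinearMap.id_apply] at h1 h2
  simp only [Pi.smul_apply]
  rw [h1, h2, map_smul, map_smul, map_smul, map_smul, ← smul_add, ← smul_add, h.2.2 t ht]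

lemma IsState.sub {u v : L2 U T} (h : P.IsState B T x₀ u x) (h' : P.IsState B T y₀ v y) :
    P.IsState B T (x₀ - y₀) (u - v : L2 U T) (fun t => x t - y t) := by
  have := h.add (h'.smul (-1))
  simpa [← sub_eq_add_neg] using this

lemma isState_zero : P.IsState B T 0 (0 : L2 U T) (fun _ => 0) := by
  refine ⟨continuousOn_const, rfl, fun t ht => ?_⟩
  rw [intervalIntegral_congr_ae_Ioo (Lp.coeFn_zero U 2 _) ht]
  simp

/-- A state that returns to `0` at time `t₀` may be extended by `0`. -/
lemma IsState.extend_zero {t₀ : ℝ} (ht₀ : 0 ≤ t₀) {u : ℝ → U} (h : P.IsState B t₀ 0 u x)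
    (hx : x t₀ = 0) : P.IsState B T 0 ((Ioo 0 t₀).indicator u) (fun t => if t ≤ t₀ then x t else 0) := by
  set x' : ℝ → X := fun t => if t ≤ t₀ then x t else 0 with hx'
  have hle : ∀ t ≤ t₀, x' t = x t := fun t ht => if_pos ht
  have hge : ∀ t, t₀ ≤ t → x' t = 0 := by
    intro t ht
    rcases ht.eq_or_lt with rfl | ht
    · rw [hle _ le_rfl, hx]
    · exact if_neg ht.not_ge
  have hc1 : ContinuousOn x' (Icc 0 t₀) := h.1.congr fun t ht => hle t ht.2
  have hc2 : ContinuousOn x' (Ici t₀) := continuousOn_const.congr fun t ht => hge t ht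
  have hc : ContinuousOn x' (Ici 0) := by
    have := hc1.union_of_isClosed hc2 isClosed_Icc isClosed_Ici
    rwa [Icc_union_Ici_eq_Ici ht₀] at this
  have e1 : ∀ t ∈ Icc 0 t₀, ∫ s in (0 : ℝ)..t, x' s = ∫ s in (0 : ℝ)..t, x s := fun t ht =>
    intervalIntegral.integral_congr fun s hs => by
      rw [uIcc_of_le ht.1] at hs
      exact hle s (hs.2.trans ht.2)
  have e2 : ∀ t ∈ Icc 0 t₀, ∫ s in (0 : ℝ)..t, (Ioo 0 t₀).indicator u s =
      ∫ s in (0 : ℝ)..t, u s := fun t ht =>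
    intervalIntegral_congr_ae_Ioo (indicator_ae_eq_restrict measurableSet_Ioo) ht
  refine ⟨hc.mono Icc_subset_Ici_self, (hle 0 ht₀).trans h.2.1, fun t ht => ?_⟩
  rcases le_total t t₀ with htt | htt
  · rw [hle t htt, e1 t ⟨ht.1, htt⟩, e2 t ⟨ht.1, htt⟩]
    exact h.2.2 t ⟨ht.1, htt⟩
  -- Beyond `t₀` both integrals keep their values at `t₀`, so the equation at `t` is the one at
  -- `t₀`, where the state is `0`.
  · have h3 : ∫ s in (0 : ℝ)..t, x' s = ∫ s in (0 : ℝ)..t₀, x s := by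
      have h0 : ∫ s in t₀..t, x' s = ∫ s in t₀..t, (0 : X) :=
        intervalIntegral.integral_congr fun s hs => by
          rw [uIcc_of_le htt] at hs
          exact hge s hs.1
      rw [← intervalIntegral.integral_add_adjacent_intervals
        (hc1.intervalIntegrable_of_Icc ht₀)
        ((hc2.mono Icc_subset_Ici_self).intervalIntegrable_of_Icc htt), h0,
        intervalIntegral.integral_zero, add_zero, e1 t₀ ⟨ht₀, le_rfl⟩]
    have h4 : ∫ s in (0 : ℝ)..t, (Ioo 0 t₀).indicator u s = ∫ s in (0 : ℝ)..t₀, u s := by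
      rw [intervalIntegral.integral_of_le ht.1, intervalIntegral.integral_of_le ht₀,
        setIntegral_indicator measurableSet_Ioo, integral_Ioc_eq_integral_Ioo,
        inter_eq_self_of_subset_right
          (Ioo_subset_Ioc_self.trans (Ioc_subset_Ioc_right htt))]
    have h5 := h.2.2 t₀ ⟨ht₀, le_rfl⟩
    rw [hge t htt, h3, h4, ← h5, hx]

variable {τ : ℝ}

/-- States that start at `0` depend continuously on the control. -/
lemma exists_norm_state_le (hτ : 0 < τ)
    (hadm : ∀ u : L2 U τ, ∃ z, P.emb z = ∫ s in Ioo 0 τ, P.op (τ - s).toNNReal (B (u s)))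
    (hT : 0 ≤ T) : ∃ C : ℝ, 0 ≤ C ∧ ∀ (u : L2 U T) (x : ℝ → X), P.IsState B T 0 u x →
      ∀ t ∈ Icc 0 T, ‖x t‖ ≤ C * ‖u‖ := by
  obtain ⟨C, hC0, hC⟩ := P.exists_norm_le_of_integral_eq B hτ hadm T
  refine ⟨C, hC0, fun u x hx t ht => ?_⟩
  -- The control is extended by zero and the state by its endpoint values; since `x 0 = 0`, both
  -- vanish at negative times.
  set g : ℝ → U := (Ioo 0 T).indicator u with hg
  set z : ℝ → X := fun t => x (projIcc 0 T hT t) with hz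
  have hzx : ∀ t ∈ Icc 0 T, z t = x t := fun t ht => by
    simp only [hz, projIcc_of_mem hT ht]
  have hgu : g =ᵐ[volume.restrict (Ioo 0 T)] u := indicator_ae_eq_restrict measurableSet_Ioo
  have hgL : MemLp g 2 volume := (memLp_indicator_iff_restrict measurableSet_Ioo).2 (Lp.memLp u)
  have hgn : (eLpNorm g 2 volume).toReal = ‖u‖ := by
    rw [hg, eLpNorm_indicator_eq_eLpNorm_restrict measurableSet_Ioo, Lp.norm_def]
  rw [← hzx t ht, ← hgn]
  refine hC z g ?_ (fun t ht => ?_) ((Lp.stronglyMeasurable u).indicator measurableSet_Ioo)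
    ((integrable_indicator_iff measurableSet_Ioo).2 (L2.integrableOn u)) hgL
    (fun t ht => indicator_of_notMem (fun h => h.1.not_ge ht) _) (fun t ht => ?_) t ht
  · exact (continuousOn_iff_continuous_domRestrict.1 hx.1).comp continuous_projIcc
  · simp only [hz, projIcc_of_le_left hT ht]
    exact hx.2.1
  · have h1 : ∫ s in (0 : ℝ)..t, z s = ∫ s in (0 : ℝ)..t, x s :=
      intervalIntegral.integral_congr fun s hs => by
        rw [uIcc_of_le ht.1] at hs
        exact hzx s ⟨hs.1, hs.2.trans ht.2⟩
    rw [hzx t ht, h1, intervalIntegral_congr_ae_Ioo hgu ht, hx.2.2 t ht, map_zero, zero_add]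

variable (P B) in
/-- The controls that steer `0` to `0` in time `T`. -/
def nullControls (T : ℝ) : Submodule 𝕜 (L2 U T) where
  carrier := {w | ∃ x, P.IsState B T 0 w x ∧ x T = 0}
  add_mem' := by
    rintro u v ⟨x, hx, hxT⟩ ⟨y, hy, hyT⟩
    exact ⟨_, by simpa using hx.add hy, by simp [hxT, hyT]⟩
  zero_mem' := ⟨_, isState_zero, rfl⟩
  smul_mem' := by
    rintro c u ⟨x, hx, hxT⟩
    exact ⟨_, by simpa using hx.smul c, by simp [hxT]⟩

lemma mem_nullControls {w : L2 U T} :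
    w ∈ P.nullControls B T ↔ ∃ x, P.IsState B T 0 w x ∧ x T = 0 := Iff.rfl

/-- Continuous dependence makes the states of a convergent sequence of null controls converge
uniformly, and the integrated equation and the terminal value pass to the limit. Closedness provides
the orthogonal projection onto this subspace. -/
lemma isClosed_nullControls (hτ : 0 < τ)
    (hadm : ∀ u : L2 U τ, ∃ z, P.emb z = ∫ s in Ioo 0 τ, P.op (τ - s).toNNReal (B (u s)))
    (hT : 0 ≤ T) : IsClosed (P.nullControls B T : Set (L2 U T)) := by
  obtain ⟨C, hC0, hC⟩ := exists_norm_state_le hτ hadm hT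
  obtain ⟨K, hK⟩ := L2.exists_norm_integral_le (F := U) T
  refine IsSeqClosed.isClosed fun w v hw hv => ?_
  choose x hx hxT using hw
  have hdiff : ∀ n m, ∀ t ∈ Icc 0 T, ‖x n t - x m t‖ ≤ C * ‖w n - w m‖ := fun n m t ht => by
    have h := (hx n).sub (hx m)
    rw [sub_zero] at h
    exact hC _ _ h t ht
  have hlim : ∀ t ∈ Icc 0 T, ∃ l, Tendsto (fun n => x n t) atTop (𝓝 l) := fun t ht => by
    refine cauchySeq_tendsto_of_complete (Metric.cauchySeq_iff.2 fun ε hε => ?_)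
    -- `C + 1` rather than `C`, which may be zero.
    obtain ⟨N, hN⟩ := Metric.cauchySeq_iff.1 hv.cauchySeq (ε / (C + 1)) (by positivity)
    refine ⟨N, fun m hm n hn => ?_⟩
    have h1 := hN m hm n hn
    rw [dist_eq_norm, lt_div_iff₀ (by positivity)] at h1
    rw [dist_eq_norm]
    refine (hdiff m n t ht).trans_lt ?_
    nlinarith [norm_nonneg (w m - w n)]
  choose! z hz using hlim
  have hv0 : Tendsto (fun n => ‖w n - v‖) atTop (𝓝 0) := tendsto_iff_norm_sub_tendsto_zero.1 hv
  have hbd : ∀ n, ∀ t ∈ Icc 0 T, ‖x n t - z t‖ ≤ C * ‖w n - v‖ := fun n t ht =>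
    le_of_tendsto_of_tendsto' ((tendsto_const_nhds.sub (hz t ht)).norm)
      ((tendsto_const_nhds.sub hv).norm.const_mul C) fun m => hdiff n m t ht
  have hCv : Tendsto (fun n => C * ‖w n - v‖) atTop (𝓝 0) := by simpa using hv0.const_mul C
  have hunif : TendstoUniformlyOn x z atTop (Icc 0 T) := by
    refine Metric.tendstoUniformlyOn_iff.2 fun ε hε => ?_
    filter_upwards [hCv.eventually_lt_const hε] with n hn t ht
    rw [dist_comm, dist_eq_norm]
    exact (hbd n t ht).trans_lt hn
  have hzc : ContinuousOn z (Icc 0 T) :=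
    hunif.continuousOn (Frequently.of_forall fun n => (hx n).1)
  refine ⟨z, ⟨hzc, ?_, fun t ht => ?_⟩, ?_⟩
  · refine tendsto_nhds_unique (hz 0 ⟨le_rfl, hT⟩) ?_
    simp only [fun n => (hx n).2.1, tendsto_const_nhds]
  · have h1 : Tendsto (fun n => ∫ s in (0 : ℝ)..t, x n s) atTop (𝓝 (∫ s in (0 : ℝ)..t, z s)) := by
      have h0 : Tendsto (fun n => C * ‖w n - v‖ * |t - 0|) atTop (𝓝 0) := by
        simpa using hCv.mul_const |t - 0|
      refine tendsto_iff_norm_sub_tendsto_zero.2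
        (squeeze_zero (fun _ => norm_nonneg _) (fun n => ?_) h0)
      rw [← intervalIntegral.integral_sub (intervalIntegrable_of_continuousOn (hx n).1 ht)
        (intervalIntegrable_of_continuousOn hzc ht)]
      refine intervalIntegral.norm_integral_le_of_norm_le_const fun s hs => ?_
      rw [uIoc_of_le ht.1] at hs
      exact hbd n s ⟨hs.1.le, hs.2.trans ht.2⟩
    have h2 : Tendsto (fun n => ∫ s in (0 : ℝ)..t, w n s) atTop
        (𝓝 (∫ s in (0 : ℝ)..t, v s)) := by
      have h0 : Tendsto (fun n => K * ‖w n - v‖) atTop (𝓝 0) := by simpa using hv0.const_mul K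
      refine tendsto_iff_norm_sub_tendsto_zero.2
        (squeeze_zero (fun _ => norm_nonneg _) (fun n => ?_) h0)
      refine le_of_eq_of_le ?_ (hK (w n - v) t ht)
      rw [← intervalIntegral.integral_sub
        (intervalIntegrable_of_integrableOn_Ioo (L2.integrableOn _) ht)
        (intervalIntegrable_of_integrableOn_Ioo (L2.integrableOn _) ht),
        intervalIntegral_congr_ae_Ioo (Lp.coeFn_sub (w n) v) ht]
      rfl
    have h3 := ((P.emb.continuous.tendsto _).comp (hz t ht)).add
      ((P.ext.continuous.tendsto _).comp h1)
    refine tendsto_nhds_unique h3 (((B.continuous.tendsto _).comp h2).const_add (P.emb 0) |>.congr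
      fun n => ((hx n).2.2 t ht).symm)
  · refine tendsto_nhds_unique (hz T ⟨hT, le_rfl⟩) ?_
    simp only [hxT, tendsto_const_nhds]

end ExtrapolationSpace

/-! ### Restricting and extending controls -/

variable {𝕜 X U : Type*} [RCLike 𝕜]
  [NormedAddCommGroup X] [InnerProductSpace 𝕜 X] [CompleteSpace X]
  [NormedAddCommGroup U] [InnerProductSpace 𝕜 U] [CompleteSpace U]

/-- The restriction of a control to a shorter time interval. -/
noncomputable def L2.restrict {T t₀ : ℝ} (h : t₀ ≤ T) (u : L2 U T) : L2 U t₀ :=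
  ((Lp.memLp u).mono_measure (Measure.restrict_mono_set _ (Ioo_subset_Ioo_right h))).toLp u

lemma L2.coeFn_restrict {T t₀ : ℝ} (h : t₀ ≤ T) (u : L2 U T) :
    L2.restrict h u =ᵐ[volume.restrict (Ioo 0 t₀)] u :=
  MemLp.coeFn_toLp _

/-- The extension of a control by `0` to a longer time interval. -/
noncomputable def L2.extend {t₀ : ℝ} (T : ℝ) (u : L2 U t₀) : L2 U T :=
  ((memLp_indicator_iff_restrict (μ := volume) measurableSet_Ioo).2 (Lp.memLp u)).restrict
    (Ioo 0 T) |>.toLp _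

lemma L2.coeFn_extend {t₀ : ℝ} (T : ℝ) (u : L2 U t₀) :
    L2.extend T u =ᵐ[volume.restrict (Ioo 0 T)] (Ioo 0 t₀).indicator u :=
  MemLp.coeFn_toLp _

/-- Testing a control that vanishes after time `t₀` only sees the time interval `(0, t₀)`. -/
lemma L2.inner_eq_inner_restrict {T t₀ : ℝ} (h : t₀ ≤ T) {z : L2 U T} {w : L2 U t₀}
    (hz : z =ᵐ[volume.restrict (Ioo 0 T)] (Ioo 0 t₀).indicator w) (q : L2 U T) :
    inner 𝕜 z q = inner 𝕜 w (L2.restrict h q) := by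
  rw [L2.inner_def, L2.inner_def]
  have h1 : ∫ s in Ioo 0 T, inner 𝕜 (z s) (q s) =
      ∫ s in Ioo 0 T, (Ioo 0 t₀).indicator (fun s => inner 𝕜 (w s) (q s)) s := by
    refine integral_congr_ae ?_
    filter_upwards [hz] with s hs
    rw [hs]
    by_cases hst : s ∈ Ioo 0 t₀ <;> simp [hst]
  rw [h1, setIntegral_indicator measurableSet_Ioo,
    inter_eq_self_of_subset_right (Ioo_subset_Ioo_right h)]
  refine integral_congr_ae ?_
  filter_upwards [L2.coeFn_restrict h q] with s hs
  rw [hs]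

/-- Solutions in the sense of `IsSolution` are states in the sense of
`ExtrapolationSpace.IsState`. -/
lemma isSolution_iff_isState [NormedSpace ℝ X] [IsScalarTower ℝ 𝕜 X] [NormedSpace ℝ U]
    {S : C0Semigroup 𝕜 X} {A : X →ₗ.[𝕜] X} (hA : S.IsGenerator (-A))
    (B : U →L[𝕜] Extrapolation A) {T : ℝ} {x₀ : X} {u : L2 U T} {x : ℝ → X} :
    IsSolution A B T x₀ u x ↔ (extrapolationSpace hA).IsState B T x₀ u x :=
  ((extrapolationSpace hA).isState_iff (L2.integrableOn u)).symm

/-- Continuity on a compact interval bounds the set above, so `sSup` is a true supremum. The lower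
bound on the penalty uses only its value at `t₀`. -/
lemma IsSolution.norm_le_sSup {A : X →ₗ.[𝕜] X} {B : U →L[𝕜] Extrapolation A} {T t₀ : ℝ} {x₀ : X}
    {u : L2 U T} {x : ℝ → X} (h : IsSolution A B T x₀ u x) (ht₀ : 0 ≤ t₀) (hT : t₀ ≤ T) (xd : X) :
    ‖x t₀ - xd‖ ≤ sSup ((fun t => ‖x t - xd‖) '' Icc t₀ T) := by
  have hc : ContinuousOn (fun t => ‖x t - xd‖) (Icc t₀ T) :=
    ((h.1.mono (Icc_subset_Icc_left ht₀)).sub continuousOn_const).norm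
  exact le_csSup (isCompact_Icc.image_of_continuousOn hc).bddAbove
    (mem_image_of_mem _ ⟨le_rfl, hT⟩)

end ExactControl

/-! ### Exactness of the penalty -/

open ExactControl in
theorem mainTheorem4 {𝕜 X U : Type*} [RCLike 𝕜]
    [NormedAddCommGroup X] [InnerProductSpace 𝕜 X] [CompleteSpace X]
    [NormedAddCommGroup U] [InnerProductSpace 𝕜 U] [CompleteSpace U]
    (A : X →ₗ.[𝕜] X) (S : ExactControl.C0Semigroup 𝕜 X) (hA : S.IsGenerator (-A))
    (B : U →L[𝕜] ExactControl.Extrapolation A) (hB : ExactControl.IsAdmissible hA B)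
    (t₀ T C₁ γ : ℝ) (ht₀ : 0 < t₀) (hT : t₀ < T)
    (hcontr : ExactControl.IsExactlyControllable A B t₀ C₁)
    (x₀ xd : X) (ud : U) (uExact : ExactControl.L2 U t₀)
    (hhold : ExactControl.IsHoldable A B t₀ T x₀ xd ud uExact)
    (hγ : C₁ * ‖uExact - ExactControl.constControl t₀ ud‖ < γ) :
    ∃ (u : ExactControl.L2 U T) (x : ℝ → X),
      ExactControl.IsOptimal A B t₀ T γ x₀ xd ud u x ∧
      (∀ (u' : ExactControl.L2 U T) (x' : ℝ → X),
        ExactControl.IsOptimal A B t₀ T γ x₀ xd ud u' x' → u' = u ∧ EqOn x' x (Icc 0 T)) ∧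
      ∀ t ∈ Icc t₀ T, x t = xd := by
  let _ : NormedSpace ℝ X := NormedSpace.restrictScalars ℝ 𝕜 X
  have : IsScalarTower ℝ 𝕜 X := RestrictScalars.isScalarTower ℝ 𝕜 X
  let _ : NormedSpace ℝ U := NormedSpace.restrictScalars ℝ 𝕜 U
  have : IsScalarTower ℝ 𝕜 U := RestrictScalars.isScalarTower ℝ 𝕜 U
  obtain ⟨τ, hτ, hadm⟩ := hB
  obtain ⟨hC₁, hcontr⟩ := hcontr
  obtain ⟨v, y, hv, hvE, hvd, hyd⟩ := hhold
  set P := extrapolationSpace hA with hP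
  have hadm' : ∀ u : L2 U τ, ∃ z,
      P.emb z = ∫ s in Ioo 0 τ, P.op (τ - s).toNNReal (B (u s)) := hadm
  have hsol : ∀ {T : ℝ} {x₀ : X} {u : L2 U T} {x : ℝ → X},
      IsSolution A B T x₀ u x ↔ P.IsState B T x₀ u x := isSolution_iff_isState hA B
  have hT0 : 0 ≤ T := (ht₀.trans hT).le
  -- the controls that steer `0` to `0`, and the best way to steer `x₀` to `xd`
  set K := P.nullControls B t₀ with hK
  have hKc : IsClosed (K : Set (L2 U t₀)) :=
    ExtrapolationSpace.isClosed_nullControls hτ hadm' ht₀.le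
  have : CompleteSpace K := hKc.completeSpace_coe
  set e : L2 U t₀ := uExact - constControl t₀ ud with he
  set k : L2 U t₀ := K.starProjection e with hk
  have hkK : k ∈ K := K.starProjection_apply_mem e
  have horth : ∀ w ∈ K, inner 𝕜 (e - k) w = 0 := fun w hw =>
    (Submodule.mem_orthogonal' K _).1 (K.sub_starProjection_mem_orthogonal e) w hw
  have hnorm : ‖e - k‖ ≤ ‖e‖ := by
    have h := norm_add_sq (𝕜 := 𝕜) (e - k) k
    rw [horth k hkK, sub_add_cancel, map_zero, mul_zero, add_zero] at h
    exact abs_le_of_sq_le_sq' (by nlinarith [sq_nonneg ‖k‖]) (norm_nonneg _) |>.2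
  obtain ⟨xk, hxk, hxk0⟩ := ExtrapolationSpace.mem_nullControls.1 hkK
  -- The state of `k` ends at `0`, so after `t₀` the correction contributes nothing and `x` stays at
  -- `xd`.
  set u : L2 U T := v - L2.extend T k with hu
  set x : ℝ → X := fun t => y t - if t ≤ t₀ then xk t else 0 with hx
  have hux : P.IsState B T x₀ u x := by
    have h := (hxk.extend_zero (T := T) ht₀.le hxk0).congr (L2.coeFn_extend T k).symm
    have h' := (hsol.1 hv).sub h
    rwa [sub_zero] at h'
  have hxd : ∀ t ∈ Icc t₀ T, x t = xd := by
    intro t ht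
    simp only [hx]
    rw [hyd t ht]
    split_ifs with h
    · rw [le_antisymm h ht.1, hxk0, sub_zero]
    · rw [sub_zero]
  set z : L2 U T := u - constControl T ud with hz
  have hzae : z =ᵐ[volume.restrict (Ioo 0 T)] (Ioo 0 t₀).indicator (e - k : L2 U t₀) := by
    have hza : ∀ᵐ s ∂volume.restrict (Ioo 0 T),
        z s = v s - (Ioo 0 t₀).indicator k s - ud := by
      filter_upwards [Lp.coeFn_sub u (constControl T ud), Lp.coeFn_sub v (L2.extend T k),
        L2.coeFn_extend T k, Lp.coeFn_const 2 (volume.restrict (Ioo 0 T)) ud] with s h1 h2 h3 h4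
      rw [hz, h1, Pi.sub_apply, hu, h2, Pi.sub_apply, h3, h4]
      rfl
    refine ae_restrict_Ioo_of_split (b := t₀) ?_ ?_
    · filter_upwards [ae_restrict_of_ae_restrict_of_subset (Ioo_subset_Ioo_right hT.le) hza, hvE,
        ae_restrict_mem measurableSet_Ioo, Lp.coeFn_sub e k,
        Lp.coeFn_sub uExact (constControl t₀ ud),
        Lp.coeFn_const 2 (volume.restrict (Ioo 0 t₀)) ud] with s h1 h2 h3 h4 h5 h6
      rw [h1, h2, indicator_of_mem h3, indicator_of_mem h3, h4, Pi.sub_apply, he, h5, Pi.sub_apply,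
        h6]
      simp only [Function.const_apply]
      abel
    · filter_upwards [ae_restrict_of_ae_restrict_of_subset (Ioo_subset_Ioo_left ht₀.le) hza, hvd,
        ae_restrict_mem measurableSet_Ioo] with s h1 h2 h3
      have h4 : s ∉ Ioo 0 t₀ := fun h => h.2.not_gt h3.1
      rw [h1, h2, indicator_of_notMem h4, indicator_of_notMem h4, sub_zero, sub_self]
  have hcost : cost t₀ T γ xd ud u x = 1 / 2 * ‖z‖ ^ 2 := by
    have himg : (fun t => ‖x t - xd‖) '' Icc t₀ T = {0} := by
      rw [image_congr (g := fun _ => (0 : ℝ)) fun t ht => by rw [hxd t ht, sub_self, norm_zero]]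
      exact (nonempty_Icc.2 hT.le).image_const 0
    rw [cost, himg, csSup_singleton, mul_zero, add_zero]
  -- The surplus `½‖u' - u‖²` yields uniqueness of the control along with optimality.
  have key : ∀ (u' : L2 U T) (x' : ℝ → X), IsSolution A B T x₀ u' x' →
      cost t₀ T γ xd ud u x + 1 / 2 * ‖u' - u‖ ^ 2 ≤ cost t₀ T γ xd ud u' x' := by
    intro u' x' h'
    set q := u' - u with hq
    set d := x' t₀ - xd with hd
    have hqs : P.IsState B T 0 q (fun t => x' t - x t) := by
      have := (hsol.1 h').sub hux
      rwa [sub_self] at this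
    have hqr : P.IsState B t₀ 0 (L2.restrict hT.le q) (fun t => x' t - x t) :=
      (hqs.mono hT.le).congr (L2.coeFn_restrict hT.le q).symm
    -- `w` cancels the miss `d` at time `t₀`, which places the restriction of `q` plus `w` in `K` at
    -- a price proportional to `‖d‖`.
    obtain ⟨w, xw, hw, hw0, hwn⟩ := hcontr 0 (-d)
    rw [norm_zero, zero_add, norm_neg] at hwn
    have hmem : L2.restrict hT.le q + w ∈ K := by
      refine ExtrapolationSpace.mem_nullControls.2 ⟨fun t => (x' t - x t) + xw t, ?_, ?_⟩
      · have := hqr.add (hsol.1 hw)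
        rwa [add_zero] at this
      · simp only
        rw [hxd t₀ ⟨le_rfl, hT.le⟩, hw0, ← hd, add_neg_cancel]
    have hin : inner 𝕜 z q = -inner 𝕜 (e - k) w := by
      have h := horth _ hmem
      rw [inner_add_right] at h
      rw [L2.inner_eq_inner_restrict hT.le hzae q, eq_neg_iff_add_eq_zero, h]
    have hre : -(‖e‖ * (C₁ * ‖d‖)) ≤ RCLike.re (inner 𝕜 z q) := by
      rw [hin, map_neg, neg_le_neg_iff]
      refine (RCLike.re_le_norm _).trans ((norm_inner_le_norm _ _).trans ?_)
      gcongr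
    have hsq : ‖u' - constControl T ud‖ ^ 2 =
        ‖z‖ ^ 2 + 2 * RCLike.re (inner 𝕜 z q) + ‖q‖ ^ 2 := by
      rw [← norm_add_sq]
      congr 2
      rw [hz, hq]
      abel
    have hsup : ‖d‖ ≤ sSup ((fun t => ‖x' t - xd‖) '' Icc t₀ T) :=
      h'.norm_le_sSup ht₀.le hT.le xd
    have hγ0 : 0 ≤ γ := le_trans (by positivity) hγ.le
    have h1 : γ * ‖d‖ ≤ γ * sSup ((fun t => ‖x' t - xd‖) '' Icc t₀ T) := by gcongr
    have h2 : C₁ * ‖e‖ * ‖d‖ ≤ γ * ‖d‖ := by gcongr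
    rw [hcost, cost, hsq]
    nlinarith
  refine ⟨u, x, ⟨hsol.2 hux, fun u' x' h' => ?_⟩, fun u' x' h' => ?_, hxd⟩
  · exact le_trans (le_add_of_nonneg_right (by positivity)) (key u' x' h')
  · have h1 := key u' x' h'.1
    have h2 := h'.2 u x (hsol.2 hux)
    have h3 : ‖u' - u‖ = 0 := by
      have : ‖u' - u‖ ^ 2 ≤ 0 := by linarith
      exact pow_eq_zero_iff two_ne_zero |>.1 (le_antisymm this (sq_nonneg _))
    -- Equal controls give equal states: the difference is a state from `0` whose control has norm
    -- `0`.
    obtain ⟨C, -, hC⟩ := ExtrapolationSpace.exists_norm_state_le (P := P) (B := B) hτ hadm' hT0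
    refine ⟨sub_eq_zero.1 (norm_eq_zero.1 h3), fun t ht => ?_⟩
    have h4 := (hsol.1 h'.1).sub hux
    rw [sub_self] at h4
    have h5 := hC _ _ h4 t ht
    rw [h3, mul_zero] at h5
    exact sub_eq_zero.1 (norm_le_zero_iff.1 h5)
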